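/- Let $K$ be a field, let $\mathbb A=K[x_1,\dots,x_n]$ with the degree reverse lexicographical (DRL) order for $x_1>\dots>x_n$, let $I\subset\mathbb A$ be an ideal with $D:=\dim_K \mathbb A/I<\infty$, and let $G$ be the reduced DRL Gröbner basis of $I$. Let $B=\{\epsilon_1<\dots<\epsilon_D\}$ be the set of monomials divisible by no leading monomial of $G$ (its classes form a $K$-basis of $\mathbb A/I$), let $F=\{x_k\epsilon_j\}\setminus B$ be the frontier, and let $d_{\min}$ and $d_{\max}$ be the minimal and maximal degree of a monomial of $F$. The multiplication matrix $T_k$ is the matrix, in the basis $B$, of the multiplication by $x_k$ on $\mathbb A/I$. Let $\omega\ge 2$ be such that two $N\times N$ matrices over $K$ can be multiplied with at most $c\,N^{\omega}$ arithmetic operations in $K$ (straight-line programs with $+,-,\times,\div$), for all $N$. Consider the following algorithm, whose input consists of the coefficients of the elements of $G$. For $d=d_{\min},\dots,d_{\max}$, form the matrix whose columns are indexed by the monomials of $F$ of degree at most $d$ in decreasing order, followed by $\epsilon_1,\dots,\epsilon_D$, and with one row, the coefficient vector of a polynomial, for each $t\in F$ of degree at most $d$ (in decreasing order): the polynomial is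 $t-\mathrm{NF}(t)$, known from the previous steps, if $\deg t<d$; the element $g$ of $G$ with leading monomial $t$ if $\deg t=d$ and there is such a $g$; and otherwise $x_k(t'-\mathrm{NF}(t'))$ for some $t'\in F$ with $t=x_kt'$. Compute the reduced row echelon form of this matrix (one call per degree of a subroutine for matrices of the block shape $\begin{pmatrix}T&B'&C'\\0&\mathrm{Id}&E\end{pmatrix}$ with $T$ upper unitriangular) and read off the polynomials $t-\mathrm{NF}(t)$ with $\deg t=d$. Finally, fill $T_1,\dots,T_n$ with the coefficients of the normal forms $\mathrm{NF}(x_k\epsilon_j)$. Then the algorithm returns the matrices $T_1,\dots,T_n$, whatever correct subroutine for the reduced row echelon form of matrices of this block shape is used. Moreover, there is such a subroutine for which the algorithm performs at most $$C\,(d_{\max}-d_{\min}+1)\,n^{\omega}D^{\omega}$$ arithmetic operations in $K$, and hence at most $C\,(d_{\max}-d_{\min}+1)\,n^{\omega}d^{\,\omega n}$ for every natural number $d$ with $D\le d^{\,n}$. Here $C$ depends only on $\omega$ and $c$, and the subroutine depends only on $K$, $\omega$ and $c$. -/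

import Mathlib

universe u

namespace MultMat

open scoped Classical

/-! ### The degree reverse lexicographical order -/

/-- Exponent vectors, to be equipped with the DRL order for `x_0 > x_1 > ... > x_{n-1}`. -/
def DRL (n : ℕ) : Type := Fin n →₀ ℕ

namespace DRL

noncomputable instance (n : ℕ) : AddCommMonoid (DRL n) :=
  inferInstanceAs (AddCommMonoid (Fin n →₀ ℕ))

/-- The identity map. -/
noncomputable def toDRL (n : ℕ) : (Fin n →₀ ℕ) ≃+ DRL n where
  toFun a := a
  invFun a := a
  map_add' _ _ := rfl

/-- The vector of partial sums `(a_0 + ... + a_{n-1}, a_0 + ... + a_{n-2}, ..., a_0)`. Comparing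
these vectors lexicographically is the DRL order; see `DRL.lt_iff` for the usual description. -/
def key {n : ℕ} (a : Fin n →₀ ℕ) : Lex (Fin n → ℕ) :=
  toLex fun i => ∑ j ∈ Finset.Iic (Fin.rev i), a j

theorem key_add {n : ℕ} (a b : Fin n →₀ ℕ) : key (a + b) = key a + key b := by
  funext i
  exact Finset.sum_add_distrib

theorem sum_Iic_eq {n : ℕ} (a : Fin n →₀ ℕ) (i : Fin n) :
    ∑ j ∈ Finset.Iic i, a j = ∑ j ∈ Finset.Iio i, a j + a i := by
  rw [← Finset.Iio_insert, Finset.sum_insert (by simp), add_comm]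

theorem degree_split {n : ℕ} (a : Fin n →₀ ℕ) (i : Fin n) :
    a.degree = ∑ j ∈ Finset.Iic i, a j + ∑ j ∈ Finset.Ioi i, a j := by
  rw [Finsupp.degree_eq_sum, ← Finset.sum_union]
  · congr 1
    ext j
    simp [le_or_gt]
  · rw [Finset.disjoint_left]
    intro j hj hj'
    simp at hj hj'
    exact absurd hj (not_le.mpr hj')

/-- Agreement of the degrees and of all the coordinates after `i` in terms of partial sums. -/
theorem tail_eq_iff {n : ℕ} (a b : Fin n →₀ ℕ) (h : a.degree = b.degree) (i : Fin n) :
    (∀ j, i < j → a j = b j) ↔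
      ∀ j, i ≤ j → ∑ k ∈ Finset.Iic j, a k = ∑ k ∈ Finset.Iic j, b k := by
  constructor
  · intro H j hj
    have h1 := degree_split a j
    have h2 := degree_split b j
    have h3 : ∑ k ∈ Finset.Ioi j, a k = ∑ k ∈ Finset.Ioi j, b k :=
      Finset.sum_congr rfl fun k hk => H k (lt_of_le_of_lt hj (by simpa using hk))
    omega
  · intro H j hj
    have h1 := sum_Iic_eq a j
    have h2 := sum_Iic_eq b j
    have h3 := H j hj.le
    have h4 : ∑ k ∈ Finset.Iio j, a k = ∑ k ∈ Finset.Iio j, b k := by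
      have hj0 : (0 : ℕ) < j := lt_of_le_of_lt (Nat.zero_le _) (Fin.lt_def.mp hj)
      have hlt : (j : ℕ) - 1 < n := by omega
      have e : Finset.Iio j = Finset.Iic (⟨(j : ℕ) - 1, hlt⟩ : Fin n) := by
        ext k
        simp only [Finset.mem_Iio, Finset.mem_Iic, Fin.lt_def, Fin.le_def]
        omega
      rw [e]
      apply H
      rw [Fin.le_def]
      rw [Fin.lt_def] at hj
      simp only
      omega
    omega

theorem key_injective (n : ℕ) : Function.Injective (key (n := n)) := by
  intro a b h
  have h' : ∀ i : Fin n, ∑ k ∈ Finset.Iic i, a k =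
      ∑ k ∈ Finset.Iic i, b k := by
    intro i
    have := congrFun h (Fin.rev i)
    simpa [key] using this
  ext j
  have h1 := sum_Iic_eq a j
  have h2 := sum_Iic_eq b j
  have h3 := h' j
  have h4 : ∑ k ∈ Finset.Iio j, a k =
      ∑ k ∈ Finset.Iio j, b k := by
    rcases Nat.eq_zero_or_pos (j : ℕ) with h0 | h0
    · have e : Finset.Iio j = ∅ := by
        ext k
        simp only [Finset.mem_Iio, Fin.lt_def, Finset.notMem_empty, iff_false]
        omega
      rw [e]
      simp
    · have hlt : (j : ℕ) - 1 < n := by omega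
      have e : Finset.Iio j = Finset.Iic (⟨(j : ℕ) - 1, hlt⟩ : Fin n) := by
        ext k
        simp only [Finset.mem_Iio, Finset.mem_Iic, Fin.lt_def, Fin.le_def]
        omega
      rw [e]
      exact h' _
  omega

noncomputable instance (n : ℕ) : LinearOrder (DRL n) := 
  LinearOrder.lift' (fun a => key ((toDRL n).symm a)) fun _ _ h => key_injective n h

theorem lt_def {n : ℕ} {a b : Fin n →₀ ℕ} : toDRL n a < toDRL n b ↔ key a < key b := Iff.rfl

theorem le_def {n : ℕ} {a b : Fin n →₀ ℕ} : toDRL n a ≤ toDRL n b ↔ key a ≤ key b := Iff.rfl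

/-- The usual description of the DRL order: `a < b` when `a` has smaller total degree, or when the
total degrees agree and, at the last coordinate where they differ, `a` is the larger one. -/
theorem lt_iff {n : ℕ} {a b : Fin n →₀ ℕ} :
    toDRL n a < toDRL n b ↔
      a.degree < b.degree ∨
        (a.degree = b.degree ∧ ∃ i, b i < a i ∧ ∀ j, i < j → a j = b j) := by
  have hk : toDRL n a < toDRL n b ↔
      ∃ i : Fin n, (∀ j, i < j → ∑ k ∈ Finset.Iic j, a k = ∑ k ∈ Finset.Iic j, b k) ∧
        ∑ k ∈ Finset.Iic i, a k < ∑ k ∈ Finset.Iic i, b k := by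
    constructor
    · rintro ⟨i, h1, h2⟩
      refine ⟨Fin.rev i, fun j hj => ?_, h2⟩
      have := h1 (Fin.rev j) (by
        show Fin.rev j < i
        rw [← Fin.rev_lt_rev, Fin.rev_rev]
        exact hj)
      simpa [key] using this
    · rintro ⟨i, h1, h2⟩
      refine ⟨Fin.rev i, fun j hj => ?_, ?_⟩
      · refine h1 (Fin.rev j) ?_
        rw [← Fin.rev_lt_rev, Fin.rev_rev]
        exact hj
      · simpa [key] using h2
  rw [hk]
  rcases Nat.eq_zero_or_pos n with rfl | hn
  · constructor
    · rintro ⟨i, -⟩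
      exact i.elim0
    · rintro (h | ⟨-, i, -⟩)
      · simp [Finsupp.degree_eq_sum] at h
      · exact i.elim0
  have htot : ∀ (a : Fin n →₀ ℕ) (i : Fin n), (i : ℕ) + 1 = n →
      ∑ k ∈ Finset.Iic i, a k = a.degree := by
    intro a i hi
    rw [degree_split a i]
    have e : Finset.Ioi i = ∅ := by
      ext k
      have := k.2
      simp only [Finset.mem_Ioi, Fin.lt_def, Finset.notMem_empty, iff_false]
      omega
    rw [e]
    simp
  have hlt : n - 1 < n := by omega
  have hlast : ((⟨n - 1, hlt⟩ : Fin n) : ℕ) + 1 = n := by simp only; omega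
  constructor
  · rintro ⟨i, h1, h2⟩
    rcases Nat.lt_or_ge ((i : ℕ) + 1) n with hi | hi
    · right
      have hdeg : a.degree = b.degree := by
        rw [← htot a _ hlast, ← htot b _ hlast]
        apply h1
        rw [Fin.lt_def]
        simp only
        omega
      have e : Finset.Iio (⟨i + 1, hi⟩ : Fin n) = Finset.Iic i := by
        ext k
        simp only [Finset.mem_Iio, Finset.mem_Iic, Fin.lt_def, Fin.le_def]
        omega
      have ha := sum_Iic_eq a ⟨i + 1, hi⟩
      have hb := sum_Iic_eq b ⟨i + 1, hi⟩
      have hab := h1 ⟨i + 1, hi⟩ (by rw [Fin.lt_def]; simp)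
      rw [e] at ha hb
      refine ⟨hdeg, ⟨i + 1, hi⟩, by omega, (tail_eq_iff a b hdeg _).2 fun j hj => h1 j ?_⟩
      rw [Fin.le_def] at hj
      rw [Fin.lt_def]
      simp only at hj
      omega
    · left
      have hi' : (i : ℕ) + 1 = n := by have := i.2; omega
      rw [← htot a i hi', ← htot b i hi']
      exact h2
  · rintro (h | ⟨hdeg, i, h1, h2⟩)
    · refine ⟨⟨n - 1, hlt⟩, fun j hj => ?_, ?_⟩
      · have := j.2
        rw [Fin.lt_def] at hj
        simp only at hj
        omega
      · rw [htot a _ hlast, htot b _ hlast]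
        exact h
    · have H := (tail_eq_iff a b hdeg i).1 h2
      have hi0 : 0 < (i : ℕ) := by
        by_contra h0
        have h0' : (i : ℕ) = 0 := by omega
        have e : Finset.Iio i = ∅ := by
          ext k
          simp only [Finset.mem_Iio, Fin.lt_def, Finset.notMem_empty, iff_false]
          omega
        have ha := sum_Iic_eq a i
        have hb := sum_Iic_eq b i
        have := H i le_rfl
        rw [e] at ha hb
        simp at ha hb
        omega
      have hlt' : (i : ℕ) - 1 < n := by have := i.2; omega
      have e : Finset.Iio i = Finset.Iic (⟨(i : ℕ) - 1, hlt'⟩ : Fin n) := by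
        ext k
        simp only [Finset.mem_Iio, Finset.mem_Iic, Fin.lt_def, Fin.le_def]
        omega
      refine ⟨⟨(i : ℕ) - 1, hlt'⟩, fun j hj => H j ?_, ?_⟩
      · rw [Fin.lt_def] at hj
        rw [Fin.le_def]
        simp only at hj
        omega
      · have ha := sum_Iic_eq a i
        have hb := sum_Iic_eq b i
        have := H i le_rfl
        rw [e] at ha hb
        omega

instance (n : ℕ) : IsOrderedAddMonoid (DRL n) where
  add_le_add_left a b h c := by
    have h' : key ((toDRL n).symm a) ≤ key ((toDRL n).symm b) := h
    show key ((toDRL n).symm a + (toDRL n).symm c) ≤ key ((toDRL n).symm b + (toDRL n).symm c)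
    rw [key_add, key_add]
    exact add_le_add_left h' _

instance (n : ℕ) : WellFoundedLT (DRL n) :=
  ⟨InvImage.wf (fun a => key ((toDRL n).symm a)) (wellFounded_lt (α := Lex (Fin n → ℕ)))⟩

end DRL

/-- The DRL order on the monomials in `n` variables, as a `MonomialOrder`. -/
noncomputable def drl (n : ℕ) : MonomialOrder (Fin n) where
  syn := DRL n
  toSyn := DRL.toDRL n
  toSyn_monotone a b h := by
    refine DRL.le_def.2 (Pi.toLex_monotone fun i => ?_)
    exact Finset.sum_le_sum fun j _ => h j

/-! ### Reduced Gröbner bases -/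

/-- `G` is the reduced Gröbner basis of `I` with respect to the monomial order `m`. -/
structure IsReducedGroebnerBasis {σ : Type} {K : Type u} [Field K] (m : MonomialOrder σ)
    (I : Ideal (MvPolynomial σ K)) (G : Finset (MvPolynomial σ K)) : Prop where
  mem_ideal : ∀ g ∈ G, g ∈ I
  span_leadingTerm :
    Ideal.span (m.leadingTerm '' (G : Set (MvPolynomial σ K))) =
      Ideal.span (m.leadingTerm '' (I : Set (MvPolynomial σ K)))
  monic : ∀ g ∈ G, m.Monic g
  reduced : ∀ g ∈ G, ∀ g' ∈ G, g' ≠ g → ∀ a ∈ g.support, ¬ m.degree g' ≤ a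

/-! ### Straight-line programs over a field and their cost -/

/-- The four arithmetic operations of a field. -/
inductive ArithOp : Type
  | add | sub | mul | div

/-- Execution of one operation; a division by zero fails. -/
noncomputable def ArithOp.exec {K : Type u} [Field K] : ArithOp → K → K → Option K
  | .add, x, y => some (x + y)
  | .sub, x, y => some (x - y)
  | .mul, x, y => some (x * y)
  | .div, x, y => if y = 0 then none else some (x / y)

/-- Straight-line programs over `K` whose current registers are indexed by `ι` and whose outputs are
indexed by `o`: stop and output some registers, or load a constant into a new register, or apply an
arithmetic operation to two registers and put the result into a new register. The new register
is `none : Option ι`. -/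
inductive SLP (K : Type u) (o : Type) : Type → Type (max u 1)
  | ret {ι : Type} (f : o → ι) : SLP K o ι
  | const {ι : Type} (a : K) (p : SLP K o (Option ι)) : SLP K o ι
  | op {ι : Type} (a : ArithOp) (x y : ι) (p : SLP K o (Option ι)) : SLP K o ι

namespace SLP

variable {K : Type u} {o r : Type}

/-- The number of arithmetic operations. -/
def cost : {ι : Type} → SLP K o ι → ℕ
  | _, ret _ => 0
  | _, const _ p => p.cost
  | _, op _ _ _ p => p.cost + 1

/-- The outputs on given register contents, or `none` if a division by zero occurs. -/
noncomputable def eval [Field K] : {ι : Type} → SLP K o ι → (ι → K) → Option (o → K)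
  | _, ret f, v => some fun x => v (f x)
  | _, const a p, v => p.eval fun x => x.elim a v
  | _, op a x y p, v => (a.exec (v x) (v y)).bind fun c => p.eval fun z => z.elim c v

/-- Feed the registers `κ` of a program from registers `ι`; no operation is performed. -/
def rename : {κ ι : Type} → SLP K o κ → (κ → ι) → SLP K o ι
  | _, _, ret f, g => ret fun x => g (f x)
  | _, _, const a p, g => const a (p.rename (Option.map g))
  | _, _, op a x y p, g => op a (g x) (g y) (p.rename (Option.map g))

/-- Run a program, then run `q` on its outputs together with some older registers `κ`. -/
def andThenAux : {κ ι : Type} → SLP K o ι → (κ → ι) → SLP K r (κ ⊕ o) → SLP K r ι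
  | _, _, ret f, g, q => q.rename (Sum.elim g f)
  | _, _, const a p, g, q => const a (p.andThenAux (fun x => some (g x)) q)
  | _, _, op a x y p, g, q => op a x y (p.andThenAux (fun x => some (g x)) q)

/-- Run `p`, then run `q` on the registers `p` started with together with the outputs of `p`. -/
def andThen {ι : Type} (p : SLP K o ι) (q : SLP K r (ι ⊕ o)) : SLP K r ι :=
  p.andThenAux id q

/-- Output the registers `addr x`, after changing the sign of those with `x` in the given list
(`zero` is a register containing `0`); one subtraction for each element of the list. -/
noncomputable def negate {α : Type} : {ι : Type} → (zero : ι) → (addr : α → ι) → List α → SLP K α ι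
  | _, _, addr, [] => ret addr
  | _, zero, addr, x :: l => op .sub zero (addr x)
      (negate (some zero) (Function.update (fun y => some (addr y)) x none) l)

end SLP

/-- Any two `N × N` matrices over `K` can be multiplied in at most `c * N ^ ω` operations. -/
def MatMulCost (K : Type u) [Field K] (ω c : ℝ) : Prop :=
  ∀ N : ℕ, ∃ p : SLP K (Fin N × Fin N) ((Fin N × Fin N) ⊕ (Fin N × Fin N)),
    (p.cost : ℝ) ≤ c * (N : ℝ) ^ ω ∧
      ∀ A B : Matrix (Fin N) (Fin N) K,
        p.eval (Sum.elim (fun x => A x.1 x.2) (fun x => B x.1 x.2)) =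
          some fun x => (A * B) x.1 x.2

/-! ### Reduced row echelon forms of block-triangular matrices -/

/-- The block shape
`[ T  B   C ]`
`[ 0  Id  E ]`
where `T` is `s × s` upper triangular with ones on the diagonal, `Id` is the `S × S` identity matrix
and the last `D` columns are arbitrary. -/
def IsBlockTriangular {K : Type u} [Field K] (s S : ℕ) {D : ℕ}
    (M : Matrix (Fin (s + S)) (Fin (s + S + D)) K) : Prop :=
  ∀ (i : Fin (s + S)) (j : Fin (s + S + D)),
    ((j : ℕ) = i → M i j = 1) ∧
    ((j : ℕ) < i → M i j = 0) ∧
    (s ≤ (i : ℕ) → (i : ℕ) < j → (j : ℕ) < s + S → M i j = 0)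

/-- `N` is the reduced row echelon form of `M`. -/
def IsRREFOf {K : Type u} [Field K] {a b : ℕ} (N M : Matrix (Fin a) (Fin b) K) : Prop :=
  N.IsReducedRowEchelon ∧ ∃ P : Matrix (Fin a) (Fin a) K, IsUnit P ∧ N = P * M

/-- A subroutine which computes the reduced row echelon form of the matrices of the above block
shape. Nothing is asked of it on other matrices. -/
structure RREFRoutine (K : Type u) [Field K] where
  prog (s S D : ℕ) : SLP K (Fin (s + S) × Fin (s + S + D)) (Fin (s + S) × Fin (s + S + D))
  correct (s S D : ℕ) (M : Matrix (Fin (s + S)) (Fin (s + S + D)) K) :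
    IsBlockTriangular s S M →
      ∃ N : Matrix (Fin (s + S)) (Fin (s + S + D)) K, IsRREFOf N M ∧
        (prog s S D).eval (fun x => M x.1 x.2) = some fun x => N x.1 x.2

/-! ### The algorithm

Monomials are represented by exponent vectors. The combinatorial data only depend on the set `L` of
the leading monomials of the Gröbner basis. -/

section Algorithm

variable {n : ℕ}

/-- The canonical basis `B`: the monomials divisible by no element of `L` (junk value `∅` if there
are infinitely many of them). -/
noncomputable def stdMonomials (L : Finset (Fin n →₀ ℕ)) : Finset (Fin n →₀ ℕ) :=
  if h : {a : Fin n →₀ ℕ | ∀ l ∈ L, ¬ l ≤ a}.Finite then h.toFinset else ∅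

/-- The frontier `F = {x_k ε | ε ∈ B} \ B`. -/
noncomputable def frontier (L : Finset (Fin n →₀ ℕ)) : Finset (Fin n →₀ ℕ) :=
  ((stdMonomials L ×ˢ (Finset.univ : Finset (Fin n))).image
    fun x => x.1 + Finsupp.single x.2 1) \ stdMonomials L

/-- The minimal degree of a monomial of the frontier. -/
noncomputable def dMin (L : Finset (Fin n →₀ ℕ)) : ℕ :=
  sInf {d | ∃ t ∈ frontier L, t.degree = d}

/-- The maximal degree of a monomial of the frontier. -/
noncomputable def dMax (L : Finset (Fin n →₀ ℕ)) : ℕ :=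
  (frontier L).sup fun t => t.degree

/-- The elements of a finite set of monomials in increasing order for DRL. -/
noncomputable def ascending (s : Finset (Fin n →₀ ℕ)) : List (Fin n →₀ ℕ) :=
  ((s.map (drl n).toSyn.toEquiv.toEmbedding).sort (· ≤ ·)).map (drl n).toSyn.symm

/-- The `i`-th element `ε_i` of `B = {ε_0 < ε_1 < ... }`. -/
noncomputable def epsilon (L : Finset (Fin n →₀ ℕ)) (i : ℕ) : Fin n →₀ ℕ :=
  (ascending (stdMonomials L)).getD i 0

/-- The row labels in degree `δ`: the frontier monomials of degree at most `δ`, decreasing. -/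
noncomputable def rowLabels (L : Finset (Fin n →₀ ℕ)) (δ : ℕ) : List (Fin n →₀ ℕ) :=
  (ascending ((frontier L).filter fun t => t.degree ≤ δ)).reverse

/-- The column labels in degree `δ`: the row labels followed by `ε_0, ε_1, ...`. -/
noncomputable def colLabels (L : Finset (Fin n →₀ ℕ)) (δ : ℕ) : List (Fin n →₀ ℕ) :=
  rowLabels L δ ++ ascending (stdMonomials L)

/-- The register with the entry in row `t` and column `m` of the matrix `M` before it is reduced in
degree `δ`. Here `coef l m` is the register with the coefficient of `m` in the element of the Gröbner
basis with leading monomial `l`, and `row t m` is the register with the entry `M[t, m]` after the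
reduction in degree `δ - 1`, so that `row t` is the polynomial `t - NF(t)` for `t` in the frontier
of degree less than `δ`. These rows are kept. The row of `t` of degree `δ` is `g` if `t` is the
leading monomial of an element `g` of the Gröbner basis, and otherwise `x_k (t' - NF(t'))` for some
`t'` in the frontier with `t = x_k t'`. -/
noncomputable def entry (L : Finset (Fin n →₀ ℕ)) (δ : ℕ) {ι : Type} (zero : ι)
    (coef row : (Fin n →₀ ℕ) → (Fin n →₀ ℕ) → ι) (t m : Fin n →₀ ℕ) : ι :=
  if t.degree < δ then row t m
  else if t ∈ L then coef t m
  else if h : ∃ k : Fin n, t k ≠ 0 ∧ t - Finsupp.single k 1 ∈ frontier L then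
    if m h.choose = 0 then zero
    else row (t - Finsupp.single h.choose 1) (m - Finsupp.single h.choose 1)
  else zero

/-- The registers of the rows `M[t]`, read from the output of the reduction in degree `δ`. -/
noncomputable def readRow (L : Finset (Fin n →₀ ℕ)) (δ : ℕ) {ι : Type} (zero : ι) (a b : ℕ)
    (t m : Fin n →₀ ℕ) : ι ⊕ (Fin a × Fin b) :=
  if h : (rowLabels L δ).idxOf t < a ∧ (colLabels L δ).idxOf m < b then
    Sum.inr (⟨(rowLabels L δ).idxOf t, h.1⟩, ⟨(colLabels L δ).idxOf m, h.2⟩)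
  else Sum.inl zero

/-- Construction of the matrices `T_k`: the entry `(k, i, j)` is the coefficient of `ε_i` in
`NF(x_k ε_j)`. The normal form of an element of `B` is itself, and the coefficients of the normal
forms of the frontier monomials `t` are the opposites of those in `M[t]`. -/
noncomputable def finish (K : Type u) (L : Finset (Fin n →₀ ℕ)) {ι : Type} (zero one : ι)
    (row : (Fin n →₀ ℕ) → (Fin n →₀ ℕ) → ι) :
    SLP K (Fin n × Fin (stdMonomials L).card × Fin (stdMonomials L).card) ι :=
  (SLP.negate zero (fun x : (Fin n →₀ ℕ) × (Fin n →₀ ℕ) => row x.1 x.2)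
    (frontier L ×ˢ stdMonomials L).toList).andThen
  (SLP.ret fun x =>
    if epsilon L x.2.2 + Finsupp.single x.1 1 ∈ stdMonomials L then
      if epsilon L x.2.1 = epsilon L x.2.2 + Finsupp.single x.1 1 then Sum.inl one
      else Sum.inl zero
    else Sum.inr (epsilon L x.2.2 + Finsupp.single x.1 1, epsilon L x.2.1))

/-- The main loop, over a list of degrees: in each degree the matrix `M` is assembled without any
operation and its reduced row echelon form is computed by one call of the subroutine. -/
noncomputable def loop {K : Type u} [Field K] (R : RREFRoutine K) (L : Finset (Fin n →₀ ℕ)) :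
    List ℕ → {ι : Type} → (zero one : ι) → (coef row : (Fin n →₀ ℕ) → (Fin n →₀ ℕ) → ι) →
      SLP K (Fin n × Fin (stdMonomials L).card × Fin (stdMonomials L).card) ι
  | [], _, zero, one, _, row => finish K L zero one row
  | δ :: ds, _, zero, one, coef, row =>
    ((R.prog ((frontier L).filter fun t => t.degree = δ).card
        ((frontier L).filter fun t => t.degree < δ).card (stdMonomials L).card).rename
      fun x => entry L δ zero coef row ((rowLabels L δ).getD x.1 0)
        ((colLabels L δ).getD x.2 0)).andThen
    (loop R L ds (Sum.inl zero) (Sum.inl one) (fun l m => Sum.inl (coef l m))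
      (readRow L δ zero _ _))

/-- The algorithm building all the multiplication matrices from the reduced DRL Gröbner basis with
set of leading monomials `L`. The input register `(l, m)` contains the coefficient of `m` in the
element of the Gröbner basis with leading monomial `l`. -/
noncomputable def algorithm {K : Type u} [Field K] (R : RREFRoutine K)
    (L : Finset (Fin n →₀ ℕ)) :
    SLP K (Fin n × Fin (stdMonomials L).card × Fin (stdMonomials L).card)
      ((Fin n →₀ ℕ) × (Fin n →₀ ℕ)) :=
  SLP.const 0 <| SLP.const 1 <|
    loop R L (List.range' (dMin L) (dMax L - dMin L + 1)) (some none) none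
      (fun l m => some (some (l, m))) (fun _ _ => some none)

/-- The leading monomials of a finite set of polynomials for DRL. -/
noncomputable def leadingMonomials {K : Type u} [Field K]
    (G : Finset (MvPolynomial (Fin n) K)) : Finset (Fin n →₀ ℕ) :=
  G.image (drl n).degree

/-- The input of the algorithm: at `(l, m)` the coefficient of `m` in the element of `G` with leading
monomial `l` (which is unique when `G` is a reduced Gröbner basis). -/
noncomputable def inputData {K : Type u} [Field K]
    (G : Finset (MvPolynomial (Fin n) K)) (x : (Fin n →₀ ℕ) × (Fin n →₀ ℕ)) : K :=
  ∑ g ∈ G.filter (fun g => (drl n).degree g = x.1), MvPolynomial.coeff x.2 g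

end Algorithm

end MultMat

/-! Correctness. The frontier `F` is treated by increasing degree. If `t` in `F` of degree `δ` is a
leading monomial of `G`, the corresponding element of `G` already is `t - NF(t)`, because `G` is
reduced. Otherwise `t = x_k t'` with `t'` in `F` (`exists_sub_single_mem_frontier`), and `x_k (t' -
NF(t'))` involves only `t` and smaller monomials of `B ∪ F`, since a variable times an element of
`B` lies in `B ∪ F`. DRL is graded, so the frontier monomials that occur have degree at most `δ`. In
decreasing order the frontier columns therefore form a unitriangular block, and the rows of smaller
degree, being relations, are rows of the identity there.

Row reduction turns this invertible block into the identity. The row of `t` becomes an element of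
`I` equal to `t` plus a combination of `B`. No nonzero element of `I` is supported on `B`
(`eq_zero_of_std`), so this row can only be `t - NF(t)`, whatever subroutine found it
(`rref_eq_coeff_relation`). `LoopInvariant.exists_step` carries this from one degree to the next,
and `exists_basis` identifies coefficients of normal forms with entries of the `T_k`.

Cost. The reduced form of `[U | R]` is `[1 | U⁻¹ R]`. A unitriangular `U` is inverted by recursive
halving at the price of a matrix product (`computes_inv`), so one degree costs a constant times
`max(|F|, D) ^ ω`, where `|F| ≤ n D`. The `|F| D` sign changes at the end are absorbed because `ω ≥
2`. -/

namespace MultMat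

open scoped Classical

/-! ### Cost and semantics of composed straight-line programs. -/

namespace SLP

variable {K : Type u} {o r : Type}

theorem cost_rename : ∀ {κ ι : Type} (p : SLP K o κ) (g : κ → ι), (p.rename g).cost = p.cost
  | _, _, ret _, _ => rfl
  | _, _, const _ p, g => cost_rename p (Option.map g)
  | _, _, op _ _ _ p, g => congrArg (· + 1) (cost_rename p (Option.map g))

theorem cost_andThenAux : ∀ {κ ι : Type} (p : SLP K o ι) (g : κ → ι) (q : SLP K r (κ ⊕ o)),
    (p.andThenAux g q).cost = p.cost + q.cost
  | _, _, ret f, g, q => by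
    show (q.rename _).cost = 0 + q.cost
    rw [cost_rename, zero_add]
  | _, _, const _ p, g, q => cost_andThenAux p (fun x => some (g x)) q
  | _, _, op _ _ _ p, g, q => by
    show (p.andThenAux _ q).cost + 1 = p.cost + 1 + q.cost
    rw [cost_andThenAux p]
    omega

theorem cost_andThen {ι : Type} (p : SLP K o ι) (q : SLP K r (ι ⊕ o)) :
    (p.andThen q).cost = p.cost + q.cost :=
  cost_andThenAux p id q

theorem cost_negate {α : Type} : ∀ {ι : Type} (zero : ι) (addr : α → ι) (l : List α),
    (negate (K := K) zero addr l).cost = l.length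
  | _, _, _, [] => rfl
  | _, _, _, _ :: l => congrArg (· + 1) (cost_negate _ _ l)

variable [Field K]

theorem eval_rename : ∀ {κ ι : Type} (p : SLP K o κ) (g : κ → ι) (v : ι → K),
    (p.rename g).eval v = p.eval fun x => v (g x)
  | _, _, ret _, _, _ => rfl
  | _, _, const a p, g, v => by
    show (p.rename (Option.map g)).eval _ = p.eval _
    rw [eval_rename p]
    congr 1
    funext x
    cases x <;> rfl
  | _, _, op a x y p, g, v => by
    show (a.exec (v (g x)) (v (g y))).bind (fun c => (p.rename (Option.map g)).eval _) =
      (a.exec (v (g x)) (v (g y))).bind _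
    congr 1
    funext c
    rw [eval_rename p]
    congr 1
    funext x
    cases x <;> rfl

/-- An arbitrary `g` is needed for the induction: each instruction of `p` adds a register, so the
old registers are re-embedded through `some`. -/
theorem eval_andThenAux : ∀ {κ ι : Type} (p : SLP K o ι) (g : κ → ι) (q : SLP K r (κ ⊕ o))
    (v : ι → K), (p.andThenAux g q).eval v =
      (p.eval v).bind fun w => q.eval (Sum.elim (fun x => v (g x)) w)
  | _, _, ret f, g, q, v => by
    show (q.rename _).eval v = q.eval _
    rw [eval_rename]
    congr 1
    funext x
    cases x <;> rfl
  | _, _, const a p, g, q, v => eval_andThenAux p (fun x => some (g x)) q _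
  | _, _, op a x y p, g, q, v => by
    show (a.exec (v x) (v y)).bind (fun c => (p.andThenAux (fun x => some (g x)) q).eval _) =
      ((a.exec (v x) (v y)).bind fun c => p.eval _).bind _
    rw [Option.bind_assoc]
    congr 1
    funext c
    rw [eval_andThenAux p]
    rfl

theorem eval_andThen {ι : Type} (p : SLP K o ι) (q : SLP K r (ι ⊕ o)) (v : ι → K) :
    (p.andThen q).eval v = (p.eval v).bind fun w => q.eval (Sum.elim v w) :=
  eval_andThenAux p id q v

/-- `Nodup` is essential, as an element listed twice would have its sign changed twice. -/
theorem eval_negate {α : Type} : ∀ (l : List α) {ι : Type} (zero : ι) (addr : α → ι) (v : ι → K),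
    l.Nodup → v zero = 0 →
      (negate zero addr l).eval v = some fun x => if x ∈ l then -v (addr x) else v (addr x)
  | [], _, zero, addr, v, _, _ => by
    simp [negate, eval]
  | x :: l, _, zero, addr, v, hl, h0 => by
    rw [List.nodup_cons] at hl
    simp only [negate, eval, ArithOp.exec, Option.bind_some]
    rw [eval_negate l _ _ _ hl.2 (by simpa using h0)]
    congr 1
    funext y
    by_cases hy : y = x
    · subst hy
      simp [hl.1, h0]
    · simp [hy]

end SLP

/-! ### Calculus of computable functions with cost bounds. -/

/-- On the register contents satisfying `P`, the function `f` is computed by a straight-line program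
with at most `B` operations. -/
def Computes {K : Type u} [Field K] {ι o : Type} (P : (ι → K) → Prop) (f : (ι → K) → o → K)
    (B : ℝ) : Prop :=
  ∃ p : SLP K o ι, (p.cost : ℝ) ≤ B ∧ ∀ v, P v → p.eval v = some (f v)

namespace Computes

variable {K : Type u} [Field K] {ι o r : Type} {P : (ι → K) → Prop} {f : (ι → K) → o → K} {a b : ℝ}

/-- Registers and the constants `0` and `1` are available at no cost. -/
theorem gather (g : o → ι ⊕ Bool) :
    Computes P (fun v x => Sum.elim v (fun b => if b then (1 : K) else 0) (g x)) 0 := by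
  refine ⟨SLP.const 0 (SLP.const 1 (SLP.ret fun x =>
    Sum.elim (fun i => some (some i)) (fun b => if b then none else some none) (g x))), ?_, ?_⟩
  · simp [SLP.cost]
  · intro v _
    simp only [SLP.eval]
    congr 1
    funext x
    rcases g x with i | b
    · rfl
    · cases b <;> rfl

theorem congr_mono {f' : (ι → K) → o → K} (h : Computes P f a) (hf : ∀ v, P v → f v = f' v)
    (hab : a ≤ b) : Computes P f' b := by
  obtain ⟨p, h1, h2⟩ := h
  exact ⟨p, h1.trans hab, fun v hv => by rw [h2 v hv, hf v hv]⟩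

/-- Further computations may use the old registers and the results of the first program. -/
theorem share {Q : (ι ⊕ o → K) → Prop} {g : (ι ⊕ o → K) → r → K} (hf : Computes P f a)
    (hg : Computes Q g b) (hQ : ∀ v, P v → Q (Sum.elim v (f v))) :
    Computes P (fun v => g (Sum.elim v (f v))) (a + b) := by
  obtain ⟨p, h1, h2⟩ := hf
  obtain ⟨q, h3, h4⟩ := hg
  refine ⟨p.andThen q, ?_, fun v hv => ?_⟩
  · rw [SLP.cost_andThen]
    push_cast
    exact add_le_add h1 h3
  · rw [SLP.eval_andThen, h2 v hv]
    exact h4 _ (hQ v hv)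

theorem comp {Q : (o → K) → Prop} {g : (o → K) → r → K} (hg : Computes Q g b)
    (hf : Computes P f a) (hQ : ∀ v, P v → Q (f v)) :
    Computes P (fun v => g (f v)) (a + b) := by
  obtain ⟨q, h3, h4⟩ := hg
  refine hf.share (Q := fun w => Q fun x => w (Sum.inr x)) (g := fun w => g fun x => w (Sum.inr x))
    ⟨q.rename Sum.inr, ?_, fun v hv => ?_⟩ hQ
  · rwa [SLP.cost_rename]
  · rw [SLP.eval_rename]
    exact h4 _ hv

/-- The second program can run after the first because `share` keeps the original registers; a free
`gather` then collects both results. -/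
theorem pair {g : (ι → K) → r → K} (hf : Computes P f a) (hg : Computes P g b) :
    Computes P (fun v => Sum.elim (f v) (g v)) (a + b) := by
  have h1 : Computes (fun w : ι ⊕ o → K => P fun x => w (Sum.inl x))
      (fun w => g fun x => w (Sum.inl x)) (0 + b) :=
    hg.comp (gather fun x => Sum.inl (Sum.inl x)) fun _ hv => hv
  have h2 := h1.share (gather (P := fun _ => True)
    (fun x : o ⊕ r => Sum.inl (x.elim (fun y => Sum.inl (Sum.inr y)) Sum.inr))) fun _ _ => trivial
  refine (hf.share h2 fun _ hv => hv).congr_mono (fun v _ => ?_) (by simp)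
  funext x
  rcases x with x | x <;> rfl

theorem neg [Fintype o] (hf : Computes P f a) :
    Computes P (fun v x => -f v x) (a + Fintype.card o) := by
  have h : Computes (fun _ => True) (fun (w : o → K) x => -w x) (Fintype.card o) := by
    refine ⟨SLP.const 0 (SLP.negate none some Finset.univ.toList), ?_, fun v _ => ?_⟩
    · simp [SLP.cost, SLP.cost_negate]
    · refine (SLP.eval_negate (K := K) _ _ _ (fun x : Option o => x.elim 0 v) (Finset.nodup_toList _)
        rfl).trans ?_
      simp
  exact h.comp hf fun _ _ => trivial

theorem mul {ω c : ℝ} (h : MatMulCost K ω c) {N : ℕ} {A B : (ι → K) → Matrix (Fin N) (Fin N) K}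
    (hA : Computes P (fun v (x : Fin N × Fin N) => A v x.1 x.2) a) (hB : Computes P (fun v (x : Fin N × Fin N) => B v x.1 x.2) b) :
    Computes P (fun v (x : Fin N × Fin N) => (A v * B v) x.1 x.2) (a + b + c * (N : ℝ) ^ ω) := by
  obtain ⟨p, h1, h2⟩ := h N
  have hp : Computes (fun _ => True) (fun w (x : Fin N × Fin N) =>
      ((Matrix.of fun i j => w (Sum.inl (i, j))) * (Matrix.of fun i j => w (Sum.inr (i, j))) :
        Matrix (Fin N) (Fin N) K) x.1 x.2) (c * (N : ℝ) ^ ω) := by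
    refine ⟨p, h1, fun w _ => ?_⟩
    rw [← h2]
    congr 1
    funext x
    rcases x with x | x <;> rfl
  exact hp.comp (hA.pair hB) fun _ _ => trivial

end Computes

/-! ### Fast inversion of unitriangular matrices. -/

/-- Upper triangular matrices with ones on the diagonal. -/
def IsUpperUnitriangular {K : Type u} [Field K] {N : ℕ} (U : Matrix (Fin N) (Fin N) K) : Prop :=
  (∀ i, U i i = 1) ∧ ∀ i j, j < i → U i j = 0

theorem IsUpperUnitriangular.isUnit_det {K : Type u} [Field K] {N : ℕ}
    {U : Matrix (Fin N) (Fin N) K} (h : IsUpperUnitriangular U) : IsUnit U.det := by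
  rw [Matrix.det_of_isUpperTriangular (fun i j hij => h.2 i j hij)]
  simp [h.1]

/-- The two halves of the index set of size `2 ^ (k + 1)`. -/
def halves (k : ℕ) : Fin (2 ^ k) ⊕ Fin (2 ^ k) ≃ Fin (2 ^ (k + 1)) :=
  finSumFinEquiv.trans (finCongr (by rw [pow_succ]; omega))

theorem halves_inl (k : ℕ) (i : Fin (2 ^ k)) : (halves k (Sum.inl i) : ℕ) = i := by
  simp [halves]

theorem halves_inr (k : ℕ) (i : Fin (2 ^ k)) : (halves k (Sum.inr i) : ℕ) = 2 ^ k + i := by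
  simp [halves, add_comm]

theorem MatMulCost.nonneg {K : Type u} [Field K] {ω c : ℝ} (h : MatMulCost K ω c) : 0 ≤ c := by
  obtain ⟨p, h1, -⟩ := h 1
  have : (0 : ℝ) ≤ p.cost := Nat.cast_nonneg _
  simpa using this.trans h1

/-- Unitriangular matrices of size `2 ^ k` can be inverted at the cost of a matrix product. -/
theorem computes_inv {K : Type u} [Field K] {ω c : ℝ} (hω : 2 ≤ ω) (h : MatMulCost K ω c) (k : ℕ) :
    Computes (fun v : Fin (2 ^ k) × Fin (2 ^ k) → K =>
        IsUpperUnitriangular (Matrix.of fun i j => v (i, j)))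
      (fun v (x : Fin (2 ^ k) × Fin (2 ^ k)) => (Matrix.of fun i j => v (i, j))⁻¹ x.1 x.2)
      ((c + 1) * ((2 ^ k : ℕ) : ℝ) ^ ω) := by
  have hc := h.nonneg
  induction k with
  | zero =>
    -- A unitriangular matrix of size `1` is the identity, its own inverse, so copying the input
    -- suffices.
    refine (Computes.gather fun x => Sum.inl x).congr_mono (fun v hv => ?_) (by positivity)
    have h1 : (Matrix.of fun i j => v (i, j)) = (1 : Matrix (Fin (2 ^ 0)) (Fin (2 ^ 0)) K) := by
      ext i j
      have hi : i = j := Subsingleton.elim (α := Fin 1) i j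
      subst hi
      simpa using hv.1 i
    funext x
    rw [h1, inv_one, ← h1]
    rfl
  | succ k ih =>
    -- The recursion follows from `[A X; 0 B]⁻¹ = [A⁻¹ -(A⁻¹ X B⁻¹); 0 B⁻¹]`: two inversions of half
    -- size, two products and one negation.
    have hA := ih.comp (P := fun v : Fin (2 ^ (k + 1)) × Fin (2 ^ (k + 1)) → K =>
        IsUpperUnitriangular (Matrix.of fun i j => v (i, j)))
      (Computes.gather fun x : Fin (2 ^ k) × Fin (2 ^ k) => Sum.inl (halves k (Sum.inl x.1), halves k (Sum.inl x.2)))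
      fun v hv => ⟨fun i => hv.1 _, fun i j hij => hv.2 _ _ (by
        rw [Fin.lt_def, halves_inl, halves_inl]; exact hij)⟩
    have hB := ih.comp (P := fun v : Fin (2 ^ (k + 1)) × Fin (2 ^ (k + 1)) → K =>
        IsUpperUnitriangular (Matrix.of fun i j => v (i, j)))
      (Computes.gather fun x : Fin (2 ^ k) × Fin (2 ^ k) => Sum.inl (halves k (Sum.inr x.1), halves k (Sum.inr x.2)))
      fun v hv => ⟨fun i => hv.1 _, fun i j hij => hv.2 _ _ (by
        rw [Fin.lt_def, halves_inr, halves_inr]; exact Nat.add_lt_add_left hij _)⟩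
    have hAX := Computes.mul h
      (A := fun w : ((Fin (2 ^ (k + 1)) × Fin (2 ^ (k + 1))) ⊕
        ((Fin (2 ^ k) × Fin (2 ^ k)) ⊕ (Fin (2 ^ k) × Fin (2 ^ k)))) → K =>
          Matrix.of fun i j => w (Sum.inr (Sum.inl (i, j))))
      (B := fun w => Matrix.of fun i j => w (Sum.inl (halves k (Sum.inl i), halves k (Sum.inr j))))
      (Computes.gather (P := fun _ => True) fun x => Sum.inl _) (Computes.gather fun x => Sum.inl _)
    have hAXB := (Computes.mul h hAX
      (B := fun w => Matrix.of fun i j => w (Sum.inr (Sum.inr (i, j))))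
      (Computes.gather fun x => Sum.inl _)).neg
    have hout := hAXB.share (Computes.gather (P := fun _ => True)
      fun x : Fin (2 ^ (k + 1)) × Fin (2 ^ (k + 1)) => Sum.inl
        (match (halves k).symm x.1, (halves k).symm x.2 with
        | Sum.inl i, Sum.inl j => Sum.inl (Sum.inr (Sum.inl (i, j)))
        | Sum.inl i, Sum.inr j => Sum.inr (i, j)
        -- The lower left block of the inverse is zero, and so is that of the input, whose registers
        -- are reused.
        | Sum.inr _, Sum.inl _ => Sum.inl (Sum.inl x)
        | Sum.inr i, Sum.inr j => Sum.inl (Sum.inr (Sum.inr (i, j))))) fun _ _ => trivial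
    refine ((hA.pair hB).share hout fun _ _ => trivial).congr_mono (fun v hv => ?_) ?_
    · funext x
      obtain ⟨i, j⟩ := x
      obtain ⟨i, rfl⟩ := (halves k).surjective i
      obtain ⟨j, rfl⟩ := (halves k).surjective j
      set M : Matrix (Fin (2 ^ (k + 1))) (Fin (2 ^ (k + 1))) K := Matrix.of fun i j => v (i, j)
      set A : Matrix (Fin (2 ^ k)) (Fin (2 ^ k)) K :=
        Matrix.of fun i j => v (halves k (Sum.inl i), halves k (Sum.inl j)) with hAdef
      set B : Matrix (Fin (2 ^ k)) (Fin (2 ^ k)) K :=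
        Matrix.of fun i j => v (halves k (Sum.inr i), halves k (Sum.inr j)) with hBdef
      set X : Matrix (Fin (2 ^ k)) (Fin (2 ^ k)) K :=
        Matrix.of fun i j => v (halves k (Sum.inl i), halves k (Sum.inr j)) with hXdef
      have h21 : ∀ i j, v (halves k (Sum.inr i), halves k (Sum.inl j)) = 0 := by
        intro i j
        refine hv.2 _ _ ?_
        rw [Fin.lt_def, halves_inl, halves_inr]
        omega
      have hAu : IsUnit A := by
        rw [Matrix.isUnit_iff_isUnit_det]
        refine IsUpperUnitriangular.isUnit_det ⟨fun i => hv.1 _, fun i j hij => hv.2 _ _ ?_⟩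
        rw [Fin.lt_def, halves_inl, halves_inl]
        exact hij
      have hBu : IsUnit B := by
        rw [Matrix.isUnit_iff_isUnit_det]
        refine IsUpperUnitriangular.isUnit_det ⟨fun i => hv.1 _, fun i j hij => hv.2 _ _ ?_⟩
        rw [Fin.lt_def, halves_inr, halves_inr]
        rw [Fin.lt_def] at hij
        omega
      have hM : M.submatrix (halves k) (halves k) = Matrix.fromBlocks A X 0 B := by
        ext i j
        rcases i with i | i <;> rcases j with j | j
        · rfl
        · rfl
        · exact h21 i j
        · rfl
      have hinv : M⁻¹.submatrix (halves k) (halves k) =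
          Matrix.fromBlocks A⁻¹ (-(A⁻¹ * X * B⁻¹)) 0 B⁻¹ := by
        rw [← Matrix.inv_submatrix_equiv, hM,
          Matrix.inv_fromBlocks_zero₂₁_of_isUnit_iff _ _ _ (iff_of_true hAu hBu)]
      have hij : M⁻¹ (halves k i) (halves k j) =
          Matrix.fromBlocks A⁻¹ (-(A⁻¹ * X * B⁻¹)) 0 B⁻¹ i j := by rw [← hinv]; rfl
      show _ = M⁻¹ (halves k i) (halves k j)
      rw [hij]
      rcases i with i | i <;> rcases j with j | j <;>
        simp only [Equiv.symm_apply_apply, Sum.elim_inl, Sum.elim_inr]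
      · rfl
      · rfl
      · exact h21 i j
      · rfl
    -- With `m = (2 ^ k) ^ ω`, the total is at most `2 (c + 1) m + 2 c m + m`, where the last `m`
    -- pays for the negation. This is at most `4 (c + 1) m ≤ 2 ^ ω (c + 1) m`, as `ω ≥ 2`.
    · have h2 : ((2 ^ (k + 1) : ℕ) : ℝ) ^ ω = 2 ^ ω * ((2 ^ k : ℕ) : ℝ) ^ ω := by
        rw [← Real.mul_rpow (by norm_num) (by positivity)]
        congr 1
        push_cast
        ring
      have h4 : (4 : ℝ) ≤ 2 ^ ω := by
        calc (4 : ℝ) = 2 ^ (2 : ℝ) := by norm_num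
          _ ≤ 2 ^ ω := Real.rpow_le_rpow_of_exponent_le (by norm_num) hω
      have hsq : ((2 ^ k : ℕ) : ℝ) * ((2 ^ k : ℕ) : ℝ) ≤ ((2 ^ k : ℕ) : ℝ) ^ ω := by
        calc ((2 ^ k : ℕ) : ℝ) * ((2 ^ k : ℕ) : ℝ) = ((2 ^ k : ℕ) : ℝ) ^ (2 : ℝ) := by
              rw [Real.rpow_two, sq]
          _ ≤ _ := Real.rpow_le_rpow_of_exponent_le (by exact_mod_cast Nat.one_le_two_pow) hω
      have hcard : (Fintype.card (Fin (2 ^ k) × Fin (2 ^ k)) : ℝ) =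
          ((2 ^ k : ℕ) : ℝ) * ((2 ^ k : ℕ) : ℝ) := by
        rw [Fintype.card_prod, Fintype.card_fin, Nat.cast_mul]
      rw [hcard, h2]
      set m : ℝ := ((2 ^ k : ℕ) : ℝ) ^ ω
      have hm : 0 ≤ m := by positivity
      have := mul_le_mul_of_nonneg_right h4 (mul_nonneg (by linarith : (0 : ℝ) ≤ c + 1) hm)
      nlinarith

/-! ### Reduced row echelon forms by inversion of the left block. -/

section Routine

variable {K : Type u} [Field K] {a b : ℕ}

/-- A matrix of the shape `[1 | R]` is in reduced row echelon form. -/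
theorem isReducedRowEchelon_of_one_left {N : Matrix (Fin a) (Fin (a + b)) K}
    (h : ∀ i j : Fin a, N i (Fin.castAdd b j) = if i = j then 1 else 0) :
    N.IsReducedRowEchelon := by
  have hlead : ∀ i, N.IsLeadingEntry i (Fin.castAdd b i) := by
    refine fun i => ⟨fun j hj => ?_, by simp [h]⟩
    have hja : (j : ℕ) < a := lt_trans (Fin.lt_def.mp hj) i.2
    have e : j = Fin.castAdd b ⟨j, hja⟩ := rfl
    rw [e, h, if_neg]
    rintro rfl
    exact lt_irrefl _ hj
  refine ⟨fun i₁ i₂ hi j hj => ?_, fun i c hc => ?_, fun i₁ i₂ c hi hc => ?_⟩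
  · have hle : j ≤ Fin.castAdd b i₁ := by
      by_contra hlt
      have := hj _ (not_le.mp hlt)
      simp [h] at this
    exact (hlead i₂).1 j (lt_of_le_of_lt hle hi)
  · rw [hc.unique (hlead i), h, if_pos rfl]
  · rw [hc.unique (hlead i₂), h, if_neg hi.ne]

/-- If the left square block of `M` is invertible, the reduced row echelon form of `M` has the shape
`[1 | R]`. -/
theorem IsRREFOf.one_left {N M : Matrix (Fin a) (Fin (a + b)) K} (h : IsRREFOf N M)
    (hM : IsUnit (M.submatrix id (Fin.castAdd b))) (i j : Fin a) :
    N i (Fin.castAdd b j) = if i = j then 1 else 0 := by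
  obtain ⟨hN, P, hP, hPM⟩ := h
  have hQ : IsUnit (N.submatrix id (Fin.castAdd b)) := by
    have e : N.submatrix id (Fin.castAdd b) = P * M.submatrix id (Fin.castAdd b) := by
      rw [hPM]
      rfl
    rw [e]
    exact hP.mul hM
  have hlead : ∀ i, ∃ c : Fin a, N.IsLeadingEntry i (Fin.castAdd b c) := by
    intro i
    have h0 : (N.submatrix id (Fin.castAdd b)) i ≠ 0 := by
      intro h0
      have hdet := (Matrix.isUnit_iff_isUnit_det _).1 hQ
      rw [Matrix.det_eq_zero_of_row_eq_zero i fun j => congrFun h0 j] at hdet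
      exact not_isUnit_zero hdet
    -- No row of an invertible block vanishes, so each row of `N` has its leading entry among the
    -- first `a` columns.
    obtain ⟨c, hc⟩ := Matrix.row_ne_zero_iff_exists_isLeadingEntry.1 h0
    refine ⟨c, fun j hj => ?_, hc.2⟩
    have hja : (j : ℕ) < a := lt_trans (Fin.lt_def.mp hj) c.2
    exact hc.1 ⟨j, hja⟩ hj
  choose c hc using hlead
  have hmono : StrictMono c := by
    intro i₁ i₂ hi
    by_contra hle
    refine (hc i₂).2 (hN.isRowEchelon hi fun j hj => (hc i₁).1 j (lt_of_lt_of_le hj ?_))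
    exact not_lt.mp hle
  -- A strictly increasing self-map of `Fin a` is the identity, so the pivots fill the diagonal.
  have hid : c = id := by
    refine (hmono.range_inj strictMono_id).1 ?_
    rw [Set.range_id, (Finite.surjective_of_injective hmono.injective).range_eq]
  have hcj := hc j
  rw [hid] at hcj
  split_ifs with hij
  · rw [hij]
    exact hN.eq_one hcj
  · exact hN.eq_zero_of_ne_of_isLeadingEntry hij hcj

variable {s S D : ℕ} {M : Matrix (Fin (s + S)) (Fin (s + S + D)) K}

theorem IsBlockTriangular.isUpperUnitriangular (h : IsBlockTriangular s S M) :
    IsUpperUnitriangular (M.submatrix id (Fin.castAdd D)) :=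
  ⟨fun i => (h i (Fin.castAdd D i)).1 rfl, fun i j hij => (h i (Fin.castAdd D j)).2.1 hij⟩

theorem IsBlockTriangular.isUnit (h : IsBlockTriangular s S M) :
    IsUnit (M.submatrix id (Fin.castAdd D)) :=
  (Matrix.isUnit_iff_isUnit_det _).2 h.isUpperUnitriangular.isUnit_det

/-- The reduced row echelon form of `[U | R]` with `U` invertible is `[1 | U⁻¹ R]`. -/
theorem isRREFOf_inv_mul (M : Matrix (Fin a) (Fin (a + b)) K)
    (hM : IsUnit (M.submatrix id (Fin.castAdd b))) :
    IsRREFOf ((M.submatrix id (Fin.castAdd b))⁻¹ * M) M := by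
  have hdet := (Matrix.isUnit_iff_isUnit_det _).1 hM
  refine ⟨isReducedRowEchelon_of_one_left fun i j => ?_, _, ?_, rfl⟩
  · have h1 := Matrix.nonsing_inv_mul _ hdet
    have h2 := congrFun (congrFun h1 i) j
    rw [Matrix.one_apply] at h2
    exact h2
  · rw [Matrix.isUnit_nonsing_inv_iff]
    exact hM

/-- Removes the padding from the sum defining an entry of a padded matrix product. -/
theorem sum_castLE {N : ℕ} (h : a ≤ N) (f : Fin N → K) (hf : ∀ l : Fin N, a ≤ (l : ℕ) → f l = 0) :
    ∑ l, f l = ∑ l : Fin a, f (Fin.castLE h l) := by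
  symm
  refine Finset.sum_of_injOn (Fin.castLE h) (Fin.castLE_injective h).injOn
    (fun _ _ => Finset.mem_coe.2 (Finset.mem_univ _)) (fun l _ hl => hf l ?_) fun _ _ => rfl
  by_contra hla
  exact hl ⟨⟨l, not_le.mp hla⟩, Finset.mem_coe.2 (Finset.mem_univ _), rfl⟩

/-- The value of a register or of one of the constants `0` and `1`. -/
def readAddr {ι : Type} (v : ι → K) (x : ι ⊕ Bool) : K :=
  Sum.elim v (fun b => if b then (1 : K) else 0) x

/-- Addresses of the entries of the left block, padded by an identity matrix. -/
def leftAddr (s S D N : ℕ) (x : Fin N × Fin N) : (Fin (s + S) × Fin (s + S + D)) ⊕ Bool :=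
  if h : (x.1 : ℕ) < s + S ∧ (x.2 : ℕ) < s + S then Sum.inl (⟨x.1, h.1⟩, Fin.castAdd D ⟨x.2, h.2⟩)
  else Sum.inr (decide (x.1 = x.2))

/-- Addresses of the entries of the right block, padded by zeros. -/
def rightAddr (s S D N : ℕ) (x : Fin N × Fin N) : (Fin (s + S) × Fin (s + S + D)) ⊕ Bool :=
  if h : (x.1 : ℕ) < s + S ∧ (x.2 : ℕ) < D then
    Sum.inl (⟨x.1, h.1⟩, Fin.natAdd (s + S) ⟨x.2, h.2⟩)
  else Sum.inr false

theorem isUpperUnitriangular_leftAddr {v : Fin (s + S) × Fin (s + S + D) → K}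
    (hv : IsBlockTriangular s S (Matrix.of fun i j => v (i, j))) (N : ℕ) :
    IsUpperUnitriangular
      (Matrix.of fun i j : Fin N => readAddr v (leftAddr s S D N (i, j))) := by
  refine ⟨fun i => ?_, fun i j hij => ?_⟩
  · by_cases h : (i : ℕ) < s + S
    · simpa [leftAddr, readAddr, h] using (hv ⟨i, h⟩ (Fin.castAdd D ⟨i, h⟩)).1 rfl
    · simp [leftAddr, readAddr, h]
  · by_cases h : (i : ℕ) < s + S ∧ (j : ℕ) < s + S
    · simpa [leftAddr, readAddr, h] using (hv ⟨i, h.1⟩ (Fin.castAdd D ⟨j, h.2⟩)).2.1 hij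
    · simp [leftAddr, readAddr, h, hij.ne']

/-- Solving the padded system solves the original one. -/
theorem padded_inv_mul {v : Fin (s + S) × Fin (s + S + D) → K}
    (hv : IsBlockTriangular s S (Matrix.of fun i j => v (i, j))) {N : ℕ} (hN : s + S ≤ N)
    (hD : D ≤ N) :
    ((Matrix.of fun i j : Fin N => readAddr v (leftAddr s S D N (i, j)))⁻¹ *
      (Matrix.of fun i j : Fin N => readAddr v (rightAddr s S D N (i, j)))).submatrix
        (Fin.castLE hN) (Fin.castLE hD) =
    ((Matrix.of fun i j => v (i, j)).submatrix id (Fin.castAdd D))⁻¹ *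
      (Matrix.of fun i j => v (i, j)).submatrix id (Fin.natAdd (s + S)) := by
  have hdet := (IsBlockTriangular.isUpperUnitriangular hv).isUnit_det
  have hdet' := (isUpperUnitriangular_leftAddr hv N).isUnit_det
  set V : Matrix (Fin N) (Fin N) K :=
    Matrix.of fun i j => readAddr v (leftAddr s S D N (i, j)) with hV
  set R : Matrix (Fin N) (Fin N) K :=
    Matrix.of fun i j => readAddr v (rightAddr s S D N (i, j)) with hR
  set M : Matrix (Fin (s + S)) (Fin (s + S + D)) K := Matrix.of fun i j => v (i, j) with hM
  have key : V * (V⁻¹ * R) = R := by rw [← mul_assoc, Matrix.mul_nonsing_inv V hdet', one_mul]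
  -- The first `s + S` rows of `V` vanish beyond column `s + S`, so `V (V⁻¹ R) = R` restricts to a
  -- system for the unpadded block.
  have hW : M.submatrix id (Fin.castAdd D) *
      (V⁻¹ * R).submatrix (Fin.castLE hN) (Fin.castLE hD) =
      M.submatrix id (Fin.natAdd (s + S)) := by
    ext i j
    have h2 := congrFun (congrFun key (Fin.castLE hN i)) (Fin.castLE hD j)
    rw [Matrix.mul_apply, sum_castLE hN] at h2
    · rw [Matrix.mul_apply]
      refine Eq.trans (Finset.sum_congr rfl fun l _ => ?_) (h2.trans ?_)
      · congr 1
        simp [hV, hM, leftAddr, readAddr]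
        rfl
      · simp [hR, hM, rightAddr, readAddr]
        rfl
    · intro l hl
      have : Fin.castLE hN i ≠ l := by
        rintro rfl
        exact absurd i.2 (not_lt.mpr hl)
      simp [hV, leftAddr, readAddr, not_lt.mpr hl, this]
  rw [← hW, ← Matrix.mul_assoc, Matrix.nonsing_inv_mul _ hdet, Matrix.one_mul]

/-- The reduced row echelon form by inversion of the left block, padded to size `2 ^ k`. -/
theorem computes_rref {ω c : ℝ} (hω : 2 ≤ ω) (hc : MatMulCost K ω c) (s S D k : ℕ)
    (hk : s + S ≤ 2 ^ k) (hD : D ≤ 2 ^ k) :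
    Computes (fun v : Fin (s + S) × Fin (s + S + D) → K =>
        IsBlockTriangular s S (Matrix.of fun i j => v (i, j)))
      (fun v (x : Fin (s + S) × Fin (s + S + D)) =>
        (((Matrix.of fun i j => v (i, j)).submatrix id (Fin.castAdd D))⁻¹ *
        (Matrix.of fun i j => v (i, j))) x.1 x.2) ((2 * c + 1) * ((2 ^ k : ℕ) : ℝ) ^ ω) := by
  have hW := Computes.mul hc
    (A := fun v : Fin (s + S) × Fin (s + S + D) → K =>
      (Matrix.of fun i j : Fin (2 ^ k) => readAddr v (leftAddr s S D (2 ^ k) (i, j)))⁻¹)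
    (B := fun v => Matrix.of fun i j : Fin (2 ^ k) => readAddr v (rightAddr s S D (2 ^ k) (i, j)))
    ((computes_inv hω hc k).comp (Computes.gather (leftAddr s S D (2 ^ k)))
      fun v hv => isUpperUnitriangular_leftAddr hv _)
    (Computes.gather (rightAddr s S D (2 ^ k)))
  -- The left block of the result is known to be the identity and is written with constants. Only
  -- the inversion, `c + 1`, and one product, `c`, contribute to `2 c + 1`.
  have hout := hW.share (Computes.gather (P := fun _ => True)
    fun x : Fin (s + S) × Fin (s + S + D) =>
      if h : (x.2 : ℕ) < s + S then Sum.inr (decide ((x.1 : ℕ) = x.2))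
      else Sum.inl (Sum.inr (Fin.castLE hk x.1, ⟨x.2 - (s + S), by omega⟩))) fun _ _ => trivial
  refine hout.congr_mono (fun v hv => ?_) (by linarith)
  funext x
  obtain ⟨i, j⟩ := x
  refine Fin.addCases (fun j => ?_) (fun j => ?_) j
  · have h1 := congrFun (congrFun (Matrix.nonsing_inv_mul _
      (IsBlockTriangular.isUpperUnitriangular hv).isUnit_det) i) j
    rw [Matrix.one_apply] at h1
    refine Eq.trans ?_ h1.symm
    simp [Fin.ext_iff]
  · simp only [Fin.val_natAdd, add_lt_iff_neg_left, not_lt_zero, dif_neg, not_false_eq_true,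
      Sum.elim_inl, Sum.elim_inr, add_tsub_cancel_left]
    exact congrFun (congrFun (padded_inv_mul hv hk hD) i) j

theorem exists_two_pow (m : ℕ) (hm : m ≠ 0) : ∃ k, m ≤ 2 ^ k ∧ 2 ^ k ≤ 2 * m := by
  refine ⟨Nat.log 2 m + 1, (Nat.lt_pow_succ_log_self one_lt_two m).le, ?_⟩
  rw [pow_succ, mul_comm]
  exact Nat.mul_le_mul_left 2 (Nat.pow_log_le_self 2 hm)

/-- For `s = 0` the matrix is `[Id | E]`, already reduced. Cost exactly zero is required there: for
`n = 0` the frontier is empty and the final bound is `0`, even when `D = 1`. -/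
theorem exists_rref_prog {ω c : ℝ} (hω : 2 ≤ ω) (hc : MatMulCost K ω c) (s S D : ℕ) :
    ∃ p : SLP K (Fin (s + S) × Fin (s + S + D)) (Fin (s + S) × Fin (s + S + D)),
      ((s = 0 → p.cost = 0) ∧
        (p.cost : ℝ) ≤ (2 * c + 1) * 2 ^ ω * ((max (s + S) D : ℕ) : ℝ) ^ ω) ∧
      ∀ M : Matrix (Fin (s + S)) (Fin (s + S + D)) K, IsBlockTriangular s S M →
        ∃ N : Matrix (Fin (s + S)) (Fin (s + S + D)) K, IsRREFOf N M ∧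
          p.eval (fun x => M x.1 x.2) = some fun x => N x.1 x.2 := by
  have hc0 := hc.nonneg
  rcases Nat.eq_zero_or_pos s with rfl | hs
  · refine ⟨SLP.ret id, ⟨fun _ => rfl, ?_⟩, fun M hM => ⟨M, ⟨?_, 1, isUnit_one, ?_⟩, rfl⟩⟩
    · simp only [SLP.cost, Nat.cast_zero]
      positivity
    · refine isReducedRowEchelon_of_one_left fun i j => ?_
      obtain ⟨h1, h2, h3⟩ := hM i (Fin.castAdd D j)
      split_ifs with hij
      · exact h1 (by rw [hij]; rfl)
      · rcases lt_or_gt_of_ne (fun h => hij (Fin.ext h) : (i : ℕ) ≠ j) with h | h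
        · exact h3 (Nat.zero_le _) h j.2
        · exact h2 h
    · exact (Matrix.one_mul M).symm
  · obtain ⟨k, hk1, hk2⟩ := exists_two_pow (max (s + S) D) (by omega)
    obtain ⟨p, hp1, hp2⟩ := computes_rref hω hc s S D k (by omega) (by omega)
    refine ⟨p, ⟨fun h => absurd h hs.ne', hp1.trans ?_⟩, fun M hM =>
      ⟨_, isRREFOf_inv_mul M hM.isUnit, hp2 (fun x => M x.1 x.2) hM⟩⟩
    -- Padding to a power of two at most doubles the size, whence the factor `2 ^ ω`.
    rw [mul_assoc, ← Real.mul_rpow (by norm_num) (by positivity)]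
    gcongr
    exact_mod_cast hk2

/-- A subroutine for the reduced row echelon forms with the cost of a matrix product. -/
theorem exists_rrefRoutine {ω c : ℝ} (hω : 2 ≤ ω) (hc : MatMulCost K ω c) :
    ∃ R : RREFRoutine K, ∀ s S D : ℕ, (s = 0 → (R.prog s S D).cost = 0) ∧
      ((R.prog s S D).cost : ℝ) ≤ (2 * c + 1) * 2 ^ ω * ((max (s + S) D : ℕ) : ℝ) ^ ω := by
  choose p hp1 hp2 using exists_rref_prog hω hc
  exact ⟨⟨p, hp2⟩, hp1⟩

end Routine

/-! ### Existence and uniqueness of normal forms. -/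

section NormalForms

open MvPolynomial

variable {n : ℕ} {K : Type u} [Field K] {I : Ideal (MvPolynomial (Fin n) K)}
  {G : Finset (MvPolynomial (Fin n) K)}

/-- DRL refines the total degree. This keeps the support of each row within the columns of its
degree step, and puts the rows of degree `δ` on top. -/
theorem drl_degree_le {a b : Fin n →₀ ℕ} (h : (drl n).toSyn a ≤ (drl n).toSyn b) :
    a.degree ≤ b.degree := by
  rcases h.eq_or_lt with h | h
  · rw [(drl n).toSyn.injective h]
  · rcases DRL.lt_iff.1 h with h | h
    · exact h.le
    · exact h.1.le

theorem mem_leadingMonomials {l : Fin n →₀ ℕ} :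
    l ∈ leadingMonomials G ↔ ∃ g ∈ G, (drl n).degree g = l :=
  Finset.mem_image

namespace IsReducedGroebnerBasis

theorem exists_le_degree (hG : IsReducedGroebnerBasis (drl n) I G) {p : MvPolynomial (Fin n) K}
    (hp : p ∈ I) (h0 : p ≠ 0) : ∃ l ∈ leadingMonomials G, l ≤ (drl n).degree p := by
  have h1 : (drl n).leadingTerm p ∈ Ideal.span ((drl n).leadingTerm '' (I : Set _)) :=
    Ideal.subset_span ⟨p, hp, rfl⟩
  have h2 : (drl n).leadingTerm '' (G : Set (MvPolynomial (Fin n) K)) =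
      (fun s => monomial s (1 : K)) '' (leadingMonomials G : Set (Fin n →₀ ℕ)) := by
    rw [leadingMonomials, Finset.coe_image, Set.image_image]
    refine Set.image_congr fun g hg => ?_
    rw [MonomialOrder.leadingTerm, (hG.monic g hg).leadingCoeff_eq_one]
  rw [← hG.span_leadingTerm, h2, mem_ideal_span_monomial_image] at h1
  refine h1 _ ?_
  rw [MonomialOrder.support_leadingTerm' h0]
  exact Finset.mem_singleton_self _

/-- The source of all uniqueness: the leading monomial of a nonzero element of `I` is a multiple of
a leading monomial of `G`, hence not standard. -/
theorem eq_zero_of_std (hG : IsReducedGroebnerBasis (drl n) I G) {p : MvPolynomial (Fin n) K}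
    (hp : p ∈ I) (hs : ∀ m ∈ p.support, ∀ l ∈ leadingMonomials G, ¬ l ≤ m) : p = 0 := by
  by_contra h0
  obtain ⟨l, hl, hle⟩ := hG.exists_le_degree hp h0
  exact hs _ ((drl n).degree_mem_support h0) l hl hle

end IsReducedGroebnerBasis

/-- `p` is a combination of monomials divisible by no element of `L` and not larger than `a`, and
congruent modulo `I` to the monomial `a`. -/
structure IsNormalForm (I : Ideal (MvPolynomial (Fin n) K)) (L : Finset (Fin n →₀ ℕ))
    (a : Fin n →₀ ℕ) (p : MvPolynomial (Fin n) K) : Prop where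
  std : ∀ m ∈ p.support, ∀ l ∈ L, ¬ l ≤ m
  le : ∀ m ∈ p.support, (drl n).toSyn m ≤ (drl n).toSyn a
  mem : monomial a 1 - p ∈ I

/-- The normal form of a monomial. -/
noncomputable def normalForm (I : Ideal (MvPolynomial (Fin n) K)) (L : Finset (Fin n →₀ ℕ))
    (a : Fin n →₀ ℕ) : MvPolynomial (Fin n) K :=
  Classical.epsilon (IsNormalForm I L a)

/-- The polynomial `a - NF(a)`. -/
noncomputable def relation (I : Ideal (MvPolynomial (Fin n) K)) (L : Finset (Fin n →₀ ℕ))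
    (a : Fin n →₀ ℕ) : MvPolynomial (Fin n) K :=
  monomial a 1 - normalForm I L a

theorem lt_of_mem_support_monomial_sub (hG : IsReducedGroebnerBasis (drl n) I G)
    {g : MvPolynomial (Fin n) K} (hg : g ∈ G) {a m : Fin n →₀ ℕ} (ha : (drl n).degree g ≤ a)
    (hm : m ∈ (monomial a (1 : K) - monomial (a - (drl n).degree g) 1 * g).support) :
    (drl n).toSyn m < (drl n).toSyn a := by
  rw [mem_support_iff, coeff_sub, coeff_monomial, coeff_monomial_mul', one_mul] at hm
  have hma : a ≠ m := by
    rintro rfl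
    rw [if_pos rfl, if_pos tsub_le_self, tsub_tsub_cancel_of_le ha,
      (hG.monic g hg).coeff_degree, sub_self] at hm
    exact hm rfl
  rw [if_neg hma, zero_sub, neg_ne_zero] at hm
  split_ifs at hm with h
  · have h1 := (drl n).le_degree (mem_support_iff.2 hm)
    have h2 := add_le_add_left h1 ((drl n).toSyn (a - (drl n).degree g))
    rw [← map_add, ← map_add, tsub_add_cancel_of_le h, add_tsub_cancel_of_le ha] at h2
    exact lt_of_le_of_ne h2 fun e => hma ((drl n).toSyn.injective e).symm
  · exact absurd rfl hm

/-- Well-founded induction on DRL: subtracting a multiple of a monic `g` cancels `a` and leaves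
smaller monomials, whose normal forms are combined linearly. -/
theorem IsReducedGroebnerBasis.exists_isNormalForm (hG : IsReducedGroebnerBasis (drl n) I G)
    (a : Fin n →₀ ℕ) : ∃ p, IsNormalForm I (leadingMonomials G) a p := by
  induction a using (InvImage.wf (drl n).toSyn wellFounded_lt).induction with | _ a ih =>
  by_cases ha : ∀ l ∈ leadingMonomials G, ¬ l ≤ a
  · have hm : ∀ m ∈ (monomial a (1 : K)).support, m = a := fun m hm =>
      Finset.mem_singleton.1 (support_monomial_subset hm)
    refine ⟨monomial a 1, fun m h => ?_, fun m h => ?_, ?_⟩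
    · rw [hm m h]
      exact ha
    · rw [hm m h]
    · rw [sub_self]
      exact I.zero_mem
  · push Not at ha
    obtain ⟨l, hl, hla⟩ := ha
    obtain ⟨g, hg, rfl⟩ := mem_leadingMonomials.1 hl
    set q := monomial a (1 : K) - monomial (a - (drl n).degree g) 1 * g with hq
    have hlt : ∀ m ∈ q.support, (drl n).toSyn m < (drl n).toSyn a := fun m hm =>
      lt_of_mem_support_monomial_sub hG hg hla hm
    have hex : ∀ m, ∃ p, m ∈ q.support → IsNormalForm I (leadingMonomials G) m p := by
      intro m
      by_cases hm : m ∈ q.support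
      · obtain ⟨p, hp⟩ := ih m (hlt m hm)
        exact ⟨p, fun _ => hp⟩
      · exact ⟨0, fun h => absurd h hm⟩
    choose p hp using hex
    have hsupp : ∀ m ∈ (∑ b ∈ q.support, q.coeff b • p b).support,
        ∃ b ∈ q.support, m ∈ (p b).support := by
      intro m hm
      rw [mem_support_iff, coeff_sum] at hm
      obtain ⟨b, hb, hbm⟩ := Finset.exists_ne_zero_of_sum_ne_zero hm
      rw [coeff_smul] at hbm
      exact ⟨b, hb, mem_support_iff.2 (right_ne_zero_of_smul hbm)⟩
    refine ⟨∑ b ∈ q.support, q.coeff b • p b, fun m hm => ?_, fun m hm => ?_, ?_⟩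
    · obtain ⟨b, hb, hbm⟩ := hsupp m hm
      exact (hp b hb).std m hbm
    · obtain ⟨b, hb, hbm⟩ := hsupp m hm
      exact ((hp b hb).le m hbm).trans (hlt b hb).le
    · have e : monomial a (1 : K) - ∑ b ∈ q.support, q.coeff b • p b =
          monomial (a - (drl n).degree g) 1 * g +
            ∑ b ∈ q.support, q.coeff b • (monomial b 1 - p b) := by
        have h1 : ∑ b ∈ q.support, q.coeff b • monomial b (1 : K) = q := by
          conv_rhs => rw [q.as_sum]
          refine Finset.sum_congr rfl fun b _ => ?_
          rw [smul_monomial, smul_eq_mul, mul_one]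
        simp only [smul_sub, Finset.sum_sub_distrib]
        rw [h1, hq]
        ring
      rw [e]
      refine I.add_mem (I.mul_mem_left _ (hG.mem_ideal g hg)) (I.sum_mem fun b hb => ?_)
      rw [smul_eq_C_mul]
      exact I.mul_mem_left _ (hp b hb).mem

theorem IsReducedGroebnerBasis.isNormalForm (hG : IsReducedGroebnerBasis (drl n) I G)
    (a : Fin n →₀ ℕ) : IsNormalForm I (leadingMonomials G) a (normalForm I (leadingMonomials G) a) :=
  Classical.epsilon_spec (hG.exists_isNormalForm a)

/-- Two standard polynomials congruent modulo `I` differ by a standard element of `I`, which is `0`.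
No bound on the monomials of `p` is needed. -/
theorem IsReducedGroebnerBasis.normalForm_eq (hG : IsReducedGroebnerBasis (drl n) I G)
    {a : Fin n →₀ ℕ} {p : MvPolynomial (Fin n) K}
    (hp : ∀ m ∈ p.support, ∀ l ∈ leadingMonomials G, ¬ l ≤ m) (hI : monomial a 1 - p ∈ I) :
    normalForm I (leadingMonomials G) a = p := by
  have h := hG.isNormalForm a
  refine sub_eq_zero.1 (hG.eq_zero_of_std ?_ fun m hm => ?_)
  · have := I.sub_mem hI h.mem
    rwa [sub_sub_sub_cancel_left] at this
  · rcases Finset.mem_union.1 (support_sub _ _ _ hm) with hm | hm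
    · exact h.std m hm
    · exact hp m hm

theorem IsReducedGroebnerBasis.linearIndependent (hG : IsReducedGroebnerBasis (drl n) I G)
    {ι : Type} {e : ι → Fin n →₀ ℕ} (he : Function.Injective e)
    (hs : ∀ i, ∀ l ∈ leadingMonomials G, ¬ l ≤ e i) :
    LinearIndependent K fun i => Ideal.Quotient.mk I (monomial (e i) 1) := by
  rw [linearIndependent_iff']
  intro s c hc i hi
  have hmem : ∑ j ∈ s, c j • monomial (e j) (1 : K) ∈ I := by
    rw [← Ideal.Quotient.eq_zero_iff_mem, map_sum]
    exact hc
  have h0 := hG.eq_zero_of_std hmem fun m hm => by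
    rw [mem_support_iff, coeff_sum] at hm
    obtain ⟨j, -, hj⟩ := Finset.exists_ne_zero_of_sum_ne_zero hm
    rw [coeff_smul, coeff_monomial] at hj
    have : e j = m := by
      by_contra h
      simp [h] at hj
    rw [← this]
    exact hs j
  have h1 := congrArg (coeff (e i)) h0
  rw [coeff_sum, coeff_zero, Finset.sum_eq_single i] at h1
  · simpa using h1
  · intro j _ hj
    simp [he.ne hj]
  · exact fun h => absurd hi h

/-- Excludes the junk value in `stdMonomials`. -/
theorem IsReducedGroebnerBasis.finite_std (hG : IsReducedGroebnerBasis (drl n) I G)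
    (hI : Module.Finite K (MvPolynomial (Fin n) K ⧸ I)) :
    {a : Fin n →₀ ℕ | ∀ l ∈ leadingMonomials G, ¬ l ≤ a}.Finite :=
  Set.finite_coe_iff.mp (hG.linearIndependent (e := Subtype.val) Subtype.val_injective
    fun i => i.2).finite_of_isNoetherian

end NormalForms
-- Standard monomials and the frontier.
section Combinatorics

variable {n : ℕ} {L : Finset (Fin n →₀ ℕ)}

theorem ascending_pairwise (s : Finset (Fin n →₀ ℕ)) :
    (ascending s).Pairwise fun a b => (drl n).toSyn a < (drl n).toSyn b := by
  rw [ascending, List.pairwise_map]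
  refine (Finset.sortedLT_sort _).pairwise.imp fun {a b} h => ?_
  simpa using h

theorem ascending_nodup (s : Finset (Fin n →₀ ℕ)) : (ascending s).Nodup :=
  (ascending_pairwise s).imp fun {a b} h e => by
    rw [e] at h
    exact lt_irrefl _ h

theorem mem_ascending {s : Finset (Fin n →₀ ℕ)} {a : Fin n →₀ ℕ} : a ∈ ascending s ↔ a ∈ s := by
  simp only [ascending, List.mem_map, Finset.mem_sort, Finset.mem_map_equiv]
  exact ⟨fun ⟨x, hx, h⟩ => h ▸ hx, fun h => ⟨(drl n).toSyn a, by simpa using h, by simp⟩⟩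

theorem length_ascending (s : Finset (Fin n →₀ ℕ)) : (ascending s).length = s.card := by
  simp [ascending]

theorem mem_stdMonomials (h : {a : Fin n →₀ ℕ | ∀ l ∈ L, ¬ l ≤ a}.Finite) {a : Fin n →₀ ℕ} :
    a ∈ stdMonomials L ↔ ∀ l ∈ L, ¬ l ≤ a := by
  rw [stdMonomials, dif_pos h, Set.Finite.mem_toFinset]
  rfl

theorem epsilon_eq {i : ℕ} (hi : i < (stdMonomials L).card) :
    epsilon L i = (ascending (stdMonomials L))[i]'(by rwa [length_ascending]) :=
  List.getD_eq_getElem _ _ _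

theorem epsilon_mem {i : ℕ} (hi : i < (stdMonomials L).card) : epsilon L i ∈ stdMonomials L := by
  rw [epsilon_eq hi, ← mem_ascending]
  exact List.getElem_mem _

theorem epsilon_injective :
    Function.Injective fun i : Fin (stdMonomials L).card => epsilon L i := by
  intro i j h
  simp only [epsilon_eq i.2, epsilon_eq j.2] at h
  exact Fin.ext ((ascending_nodup _).getElem_inj_iff.1 h)

theorem exists_epsilon_eq {a : Fin n →₀ ℕ} (ha : a ∈ stdMonomials L) :
    ∃ i : Fin (stdMonomials L).card, epsilon L i = a := by
  obtain ⟨i, hi, h⟩ := List.getElem_of_mem (mem_ascending.2 ha)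
  rw [length_ascending] at hi
  exact ⟨⟨i, hi⟩, by rw [epsilon_eq hi, h]⟩

theorem mem_frontier {t : Fin n →₀ ℕ} :
    t ∈ frontier L ↔
      (∃ e ∈ stdMonomials L, ∃ k, e + Finsupp.single k 1 = t) ∧ t ∉ stdMonomials L := by
  simp only [frontier, Finset.mem_sdiff, Finset.mem_image, Finset.mem_product, Finset.mem_univ,
    and_true, Prod.exists]
  refine and_congr_left fun _ => ⟨?_, ?_⟩
  · rintro ⟨e, k, he, h⟩
    exact ⟨e, he, k, h⟩
  · rintro ⟨e, he, k, h⟩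
    exact ⟨e, k, he, h⟩

theorem card_frontier_le : (frontier L).card ≤ n * (stdMonomials L).card := by
  refine (Finset.card_le_card Finset.sdiff_subset).trans (Finset.card_image_le.trans ?_)
  rw [Finset.card_product, Finset.card_univ, Fintype.card_fin, mul_comm]

/-- Write `m = x_j e` with `e` in `B`. Then `m / x_k` is `e` if `j = k`, and otherwise `x_j (e /
x_k)` with `e / x_k` in `B`, because `B` is closed under divisors. -/
theorem sub_single_mem_or {L : Finset (Fin n →₀ ℕ)}
    (h : {a : Fin n →₀ ℕ | ∀ l ∈ L, ¬ l ≤ a}.Finite) {m : Fin n →₀ ℕ} {k : Fin n} (hk : m k ≠ 0)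
    (hm : m ∈ frontier L) :
    m - Finsupp.single k 1 ∈ stdMonomials L ∨ m - Finsupp.single k 1 ∈ frontier L := by
  by_cases hB : m - Finsupp.single k 1 ∈ stdMonomials L
  · exact Or.inl hB
  obtain ⟨⟨e, he, j, rfl⟩, -⟩ := mem_frontier.1 hm
  refine Or.inr (mem_frontier.2 ⟨⟨e - Finsupp.single k 1, ?_, j, ?_⟩, hB⟩)
  · rw [mem_stdMonomials h] at he ⊢
    exact fun l hl hle => he l hl (hle.trans tsub_le_self)
  · rcases eq_or_ne j k with rfl | hjk
    · rw [add_tsub_cancel_right] at hB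
      exact absurd he hB
    · have hek : Finsupp.single k 1 ≤ e := by
        rw [Finsupp.single_le_iff, Nat.one_le_iff_ne_zero]
        simpa [hjk] using hk
      exact tsub_add_eq_add_tsub hek

/-- Some `l` in `L` divides `t` properly, so `l` still divides `t / x_k` for some `k`. That quotient
is not standard, hence it is in the frontier. So the last, junk branch of `entry` is never reached
for row labels. -/
theorem exists_sub_single_mem_frontier (h : {a : Fin n →₀ ℕ | ∀ l ∈ L, ¬ l ≤ a}.Finite)
    {t : Fin n →₀ ℕ} (ht : t ∈ frontier L) (htL : t ∉ L) :
    ∃ k, t k ≠ 0 ∧ t - Finsupp.single k 1 ∈ frontier L := by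
  have hB := (mem_frontier.1 ht).2
  rw [mem_stdMonomials h] at hB
  push Not at hB
  obtain ⟨l, hl, hlt⟩ := hB
  obtain ⟨k, hk⟩ : ∃ k, l k < t k := by
    by_contra hne
    push Not at hne
    exact htL (le_antisymm hlt hne ▸ hl)
  have hk0 : t k ≠ 0 := by omega
  refine ⟨k, hk0, (sub_single_mem_or h hk0 ht).resolve_left fun hmem => ?_⟩
  refine (mem_stdMonomials h).1 hmem l hl fun j => ?_
  rw [Finsupp.tsub_apply]
  rcases eq_or_ne k j with rfl | hkj
  · rw [Finsupp.single_eq_same]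
    omega
  · simpa [hkj] using hlt j

theorem single_le_of_ne_zero {t : Fin n →₀ ℕ} {k : Fin n} (hk : t k ≠ 0) :
    Finsupp.single k 1 ≤ t :=
  Finsupp.single_le_iff.2 (Nat.one_le_iff_ne_zero.2 hk)

theorem degree_sub_single {t : Fin n →₀ ℕ} {k : Fin n} (hk : t k ≠ 0) :
    (t - Finsupp.single k 1).degree + 1 = t.degree := by
  have h := congrArg Finsupp.degree (tsub_add_cancel_of_le (single_le_of_ne_zero hk))
  rwa [map_add, Finsupp.degree_single] at h

end Combinatorics

/-! ### Relations, row polynomials and their reduction. -/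

section Polynomials

open MvPolynomial

variable {n : ℕ} {K : Type u} [Field K] {I : Ideal (MvPolynomial (Fin n) K)}
  {G : Finset (MvPolynomial (Fin n) K)}

namespace IsReducedGroebnerBasis

theorem mem_stdMonomials_of_mem_support (hG : IsReducedGroebnerBasis (drl n) I G)
    (hI : Module.Finite K (MvPolynomial (Fin n) K ⧸ I)) {a m : Fin n →₀ ℕ}
    (hm : coeff m (normalForm I (leadingMonomials G) a) ≠ 0) :
    m ∈ stdMonomials (leadingMonomials G) :=
  (mem_stdMonomials (hG.finite_std hI)).2 ((hG.isNormalForm a).std m (mem_support_iff.2 hm))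

/-- The basis of the quotient by the classes of the standard monomials. -/
theorem exists_basis (hG : IsReducedGroebnerBasis (drl n) I G)
    (hI : Module.Finite K (MvPolynomial (Fin n) K ⧸ I)) :
    ∃ b : Module.Basis (Fin (stdMonomials (leadingMonomials G)).card) K
        (MvPolynomial (Fin n) K ⧸ I),
      (∀ i, b i = Ideal.Quotient.mk I (monomial (epsilon (leadingMonomials G) i) 1)) ∧
      ∀ t i, b.repr (Ideal.Quotient.mk I (monomial t 1)) i =
        coeff (epsilon (leadingMonomials G) i) (normalForm I (leadingMonomials G) t) := by
  set L := leadingMonomials G with hL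
  have hfin := hG.finite_std hI
  have hli := hG.linearIndependent (epsilon_injective (L := L))
    fun i => (mem_stdMonomials hfin).1 (epsilon_mem i.2)
  have hmk : ∀ t, Ideal.Quotient.mk I (monomial t 1) = ∑ i : Fin (stdMonomials L).card,
      coeff (epsilon L i) (normalForm I L t) •
        Ideal.Quotient.mk I (monomial (epsilon L i) 1) := by
    intro t
    have h1 := Ideal.Quotient.eq.2 (hG.isNormalForm t).mem
    have h2 : normalForm I L t = ∑ i : Fin (stdMonomials L).card,
        coeff (epsilon L i) (normalForm I L t) • monomial (epsilon L i) (1 : K) := by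
      ext m
      rw [coeff_sum]
      simp only [coeff_smul, coeff_monomial, smul_eq_mul, mul_ite, mul_one, mul_zero]
      by_cases hm : coeff m (normalForm I L t) = 0
      · rw [hm, Finset.sum_eq_zero]
        intro i _
        split_ifs with h
        · rw [h, hm]
        · rfl
      · obtain ⟨i, rfl⟩ := exists_epsilon_eq (hG.mem_stdMonomials_of_mem_support hI hm)
        rw [Finset.sum_eq_single i, if_pos rfl]
        · intro j _ hj
          rw [if_neg (epsilon_injective.ne hj)]
        · exact fun h => absurd (Finset.mem_univ _) h
    rw [h1]
    conv_lhs => rw [h2]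
    rw [map_sum]
    rfl
  have hspan : ⊤ ≤ Submodule.span K (Set.range fun i : Fin (stdMonomials L).card =>
      Ideal.Quotient.mk I (monomial (epsilon L i) (1 : K))) := by
    rintro x -
    obtain ⟨p, rfl⟩ := Ideal.Quotient.mk_surjective x
    induction p using MvPolynomial.induction_on' with
    | monomial a c =>
      have e : Ideal.Quotient.mk I (monomial a c) = c • Ideal.Quotient.mk I (monomial a 1) := by
        rw [← Ideal.Quotient.mkₐ_eq_mk K, ← map_smul, smul_monomial, smul_eq_mul, mul_one]
      rw [e, hmk]
      exact Submodule.smul_mem _ _ (Submodule.sum_mem _ fun i _ =>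
        Submodule.smul_mem _ _ (Submodule.subset_span ⟨i, rfl⟩))
    | add p q hp hq =>
      rw [map_add]
      exact Submodule.add_mem _ hp hq
  refine ⟨Module.Basis.mk hli hspan, fun i => Module.Basis.mk_apply _ _ _, fun t i => ?_⟩
  rw [hmk t, map_sum, Finsupp.finsetSum_apply, Finset.sum_eq_single i]
  · rw [map_smul, ← Module.Basis.mk_apply hli hspan i, Module.Basis.repr_self]
    simp
  · intro j _ hj
    rw [map_smul, ← Module.Basis.mk_apply hli hspan j, Module.Basis.repr_self]
    simp [hj.symm]
  · exact fun h => absurd (Finset.mem_univ _) h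

theorem normalForm_of_std (hG : IsReducedGroebnerBasis (drl n) I G) {t : Fin n →₀ ℕ}
    (ht : ∀ l ∈ leadingMonomials G, ¬ l ≤ t) :
    normalForm I (leadingMonomials G) t = monomial t 1 := by
  refine hG.normalForm_eq (fun m hm => ?_) (by rw [sub_self]; exact I.zero_mem)
  rw [Finset.mem_singleton.1 (support_monomial_subset hm)]
  exact ht

/-- The elements of a reduced Gröbner basis are the relations of the leading monomials. -/
theorem inputData_eq (hG : IsReducedGroebnerBasis (drl n) I G) {t : Fin n →₀ ℕ}
    (ht : t ∈ leadingMonomials G) (m : Fin n →₀ ℕ) :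
    inputData G (t, m) = coeff m (relation I (leadingMonomials G) t) := by
  obtain ⟨g, hg, rfl⟩ := mem_leadingMonomials.1 ht
  have hne : ∀ g' ∈ G, g' ≠ g → ∀ a ∈ g.support, ¬ (drl n).degree g' ≤ a := hG.reduced g hg
  -- Distinct elements of a reduced basis have distinct leading monomials, so the sum in `inputData`
  -- has one term.
  have hfil : G.filter (fun g' => (drl n).degree g' = (drl n).degree g) = {g} := by
    ext g'
    rw [Finset.mem_filter, Finset.mem_singleton]
    refine ⟨fun h => ?_, fun h => by rw [h]; exact ⟨hg, rfl⟩⟩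
    by_contra hgg
    exact hne g' h.1 hgg _ ((drl n).degree_mem_support (hG.monic g hg).ne_zero) h.2.le
  have hnf : normalForm I (leadingMonomials G) ((drl n).degree g) =
      monomial ((drl n).degree g) 1 - g := by
    refine hG.normalForm_eq (fun m hm l hl hle => ?_) ?_
    · rw [mem_support_iff, coeff_sub, coeff_monomial] at hm
      split_ifs at hm with h
      · rw [← h, (hG.monic g hg).coeff_degree, sub_self] at hm
        exact hm rfl
      · rw [zero_sub, neg_ne_zero, ← mem_support_iff] at hm
        obtain ⟨g', hg', rfl⟩ := mem_leadingMonomials.1 hl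
        rcases eq_or_ne g' g with rfl | hgg
        · exact h ((drl n).toSyn.injective
            (le_antisymm ((drl n).toSyn_monotone hle) ((drl n).le_degree hm)))
        · exact hne g' hg' hgg m hm hle
    · rw [sub_sub_cancel]
      exact hG.mem_ideal g hg
  rw [inputData, hfil, Finset.sum_singleton, relation, hnf, sub_sub_cancel]

theorem relation_mem (hG : IsReducedGroebnerBasis (drl n) I G) (t : Fin n →₀ ℕ) :
    relation I (leadingMonomials G) t ∈ I :=
  (hG.isNormalForm t).mem

theorem coeff_relation_self (hG : IsReducedGroebnerBasis (drl n) I G)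
    (hI : Module.Finite K (MvPolynomial (Fin n) K ⧸ I)) {t : Fin n →₀ ℕ}
    (ht : t ∈ frontier (leadingMonomials G)) :
    coeff t (relation I (leadingMonomials G) t) = 1 := by
  rw [relation, coeff_sub, coeff_monomial, if_pos rfl, sub_eq_self]
  by_contra h
  exact (mem_frontier.1 ht).2 (hG.mem_stdMonomials_of_mem_support hI h)

theorem mem_and_lt_of_coeff_relation (hG : IsReducedGroebnerBasis (drl n) I G)
    (hI : Module.Finite K (MvPolynomial (Fin n) K ⧸ I)) {t m : Fin n →₀ ℕ}
    (hm : coeff m (relation I (leadingMonomials G) t) ≠ 0) (hmt : m ≠ t) :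
    m ∈ stdMonomials (leadingMonomials G) ∧ (drl n).toSyn m < (drl n).toSyn t := by
  rw [relation, coeff_sub, coeff_monomial, if_neg hmt.symm, zero_sub, neg_ne_zero] at hm
  exact ⟨hG.mem_stdMonomials_of_mem_support hI hm,
    lt_of_le_of_ne ((hG.isNormalForm t).le m (mem_support_iff.2 hm))
      fun e => hmt ((drl n).toSyn.injective e)⟩

end IsReducedGroebnerBasis

/-- The rows of the matrix: elements of the ideal with leading monomial `t`, monic, and supported in
`t`, smaller frontier monomials and standard monomials. -/
structure IsRowPolynomial (I : Ideal (MvPolynomial (Fin n) K)) (L : Finset (Fin n →₀ ℕ))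
    (t : Fin n →₀ ℕ) (q : MvPolynomial (Fin n) K) : Prop where
  mem : q ∈ I
  coeff_self : coeff t q = 1
  lt : ∀ m, coeff m q ≠ 0 → m ≠ t →
    (m ∈ stdMonomials L ∨ m ∈ frontier L) ∧ (drl n).toSyn m < (drl n).toSyn t

namespace IsReducedGroebnerBasis

theorem isRowPolynomial_relation (hG : IsReducedGroebnerBasis (drl n) I G)
    (hI : Module.Finite K (MvPolynomial (Fin n) K ⧸ I)) {t : Fin n →₀ ℕ}
    (ht : t ∈ frontier (leadingMonomials G)) :
    IsRowPolynomial I (leadingMonomials G) t (relation I (leadingMonomials G) t) :=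
  ⟨hG.relation_mem t, hG.coeff_relation_self hI ht, fun _ hm hmt =>
    (hG.mem_and_lt_of_coeff_relation hI hm hmt).imp_left Or.inl⟩

/-- Multiplication by `x_k` preserves strict inequalities of monomials and sends a standard monomial
to a standard or a frontier one. -/
theorem isRowPolynomial_X_mul (hG : IsReducedGroebnerBasis (drl n) I G)
    (hI : Module.Finite K (MvPolynomial (Fin n) K ⧸ I)) {t : Fin n →₀ ℕ} {k : Fin n}
    (hk : t k ≠ 0) (ht' : t - Finsupp.single k 1 ∈ frontier (leadingMonomials G)) :
    IsRowPolynomial I (leadingMonomials G) t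
      (X k * relation I (leadingMonomials G) (t - Finsupp.single k 1)) := by
  refine ⟨I.mul_mem_left _ (hG.relation_mem _), ?_, fun m hm hmt => ?_⟩
  · rw [coeff_X_mul', if_pos (Finsupp.mem_support_iff.2 hk), hG.coeff_relation_self hI ht']
  · rw [coeff_X_mul'] at hm
    split_ifs at hm with hmk
    · have hmk' := single_le_of_ne_zero (Finsupp.mem_support_iff.1 hmk)
      have htk := single_le_of_ne_zero hk
      have hne : m - Finsupp.single k 1 ≠ t - Finsupp.single k 1 := by
        intro h
        apply hmt
        rw [← tsub_add_cancel_of_le hmk', h, tsub_add_cancel_of_le htk]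
      obtain ⟨h1, h2⟩ := hG.mem_and_lt_of_coeff_relation hI hm hne
      refine ⟨?_, ?_⟩
      · by_cases hmB : m ∈ stdMonomials (leadingMonomials G)
        · exact Or.inl hmB
        · exact Or.inr (mem_frontier.2 ⟨⟨_, h1, k, tsub_add_cancel_of_le hmk'⟩, hmB⟩)
      · have h3 := add_lt_add_left h2 ((drl n).toSyn (Finsupp.single k 1))
        rwa [← map_add, ← map_add, tsub_add_cancel_of_le hmk', tsub_add_cancel_of_le htk] at h3
    · exact absurd rfl hm

/-- The rows after the reduction are the relations of the frontier monomials. -/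
theorem rref_eq_coeff_relation (hG : IsReducedGroebnerBasis (drl n) I G) {a b : ℕ}
    {cl : Fin (a + b) → Fin n →₀ ℕ} (hcl : Function.Injective cl)
    (hstd : ∀ j, ∀ l ∈ leadingMonomials G, ¬ l ≤ cl (Fin.natAdd a j))
    {Q : Fin a → MvPolynomial (Fin n) K} (hQ : ∀ i, Q i ∈ I)
    (hsupp : ∀ i m, coeff m (Q i) ≠ 0 → ∃ j, cl j = m) {M N : Matrix (Fin a) (Fin (a + b)) K}
    (hM : ∀ i j, M i j = coeff (cl j) (Q i)) (hU : IsUnit (M.submatrix id (Fin.castAdd b)))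
    (hN : IsRREFOf N M) (i : Fin a) (j : Fin (a + b)) :
    N i j = coeff (cl j) (relation I (leadingMonomials G) (cl (Fin.castAdd b i))) := by
  obtain ⟨P, -, hP⟩ := hN.2
  -- `R` is the polynomial with coefficient vector row `i` of `N = P * M`; as a combination of the
  -- `Q l` it lies in `I`.
  set R := ∑ l, P i l • Q l with hR
  have hRI : R ∈ I := I.sum_mem fun l _ => by
    rw [smul_eq_C_mul]
    exact I.mul_mem_left _ (hQ l)
  have hRc : ∀ j, coeff (cl j) R = N i j := by
    intro j
    rw [hP, Matrix.mul_apply, hR, coeff_sum]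
    exact Finset.sum_congr rfl fun l _ => by rw [coeff_smul, hM, smul_eq_mul]
  have hRs : ∀ m, coeff m R ≠ 0 → ∃ j, cl j = m := by
    intro m hm
    rw [hR, coeff_sum] at hm
    obtain ⟨l, -, hl⟩ := Finset.exists_ne_zero_of_sum_ne_zero hm
    rw [coeff_smul] at hl
    exact hsupp l m (right_ne_zero_of_smul hl)
  have hnf : normalForm I (leadingMonomials G) (cl (Fin.castAdd b i)) =
      monomial (cl (Fin.castAdd b i)) 1 - R := by
    refine hG.normalForm_eq (fun m hm => ?_) (by rwa [sub_sub_cancel])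
    rw [mem_support_iff, coeff_sub, coeff_monomial] at hm
    have hex : ∃ j, cl j = m := by
      by_cases h : cl (Fin.castAdd b i) = m
      · exact ⟨_, h⟩
      · rw [if_neg h, zero_sub, neg_ne_zero] at hm
        exact hRs m hm
    obtain ⟨j, rfl⟩ := hex
    rw [hRc] at hm
    -- In the left columns row `i` of `N` is a row of the identity, so subtracting `R` from the
    -- label of row `i` leaves only standard monomials.
    refine Fin.addCases (fun j hm => ?_) (fun j _ => hstd j) j hm
    rw [hN.one_left hU] at hm
    rcases eq_or_ne i j with rfl | hij
    · simp at hm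
    · rw [if_neg fun h => hij (Fin.castAdd_injective _ _ (hcl h)), if_neg hij, sub_zero] at hm
      exact absurd rfl hm
  rw [relation, hnf, sub_sub_cancel, hRc]

end IsReducedGroebnerBasis

end Polynomials

/-! ### Row and column labels of the matrices. -/

section Labels

variable {n : ℕ} {L : Finset (Fin n →₀ ℕ)} {δ : ℕ}

theorem mem_rowLabels {t : Fin n →₀ ℕ} :
    t ∈ rowLabels L δ ↔ t ∈ frontier L ∧ t.degree ≤ δ := by
  rw [rowLabels, List.mem_reverse, mem_ascending, Finset.mem_filter]

theorem mem_colLabels {t : Fin n →₀ ℕ} :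
    t ∈ colLabels L δ ↔ (t ∈ frontier L ∧ t.degree ≤ δ) ∨ t ∈ stdMonomials L := by
  rw [colLabels, List.mem_append, mem_rowLabels, mem_ascending]

theorem rowLabels_pairwise (L : Finset (Fin n →₀ ℕ)) (δ : ℕ) :
    (rowLabels L δ).Pairwise fun a b => (drl n).toSyn b < (drl n).toSyn a :=
  List.pairwise_reverse.2 (ascending_pairwise _)

theorem rowLabels_nodup (L : Finset (Fin n →₀ ℕ)) (δ : ℕ) : (rowLabels L δ).Nodup :=
  List.nodup_reverse.2 (ascending_nodup _)

theorem colLabels_nodup (L : Finset (Fin n →₀ ℕ)) (δ : ℕ) : (colLabels L δ).Nodup := by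
  refine (rowLabels_nodup L δ).append (ascending_nodup _) fun t ht ht' => ?_
  exact (mem_frontier.1 (mem_rowLabels.1 ht).1).2 (mem_ascending.1 ht')

theorem length_rowLabels (L : Finset (Fin n →₀ ℕ)) (δ : ℕ) : (rowLabels L δ).length =
    ((frontier L).filter fun t => t.degree = δ).card +
      ((frontier L).filter fun t => t.degree < δ).card := by
  rw [rowLabels, List.length_reverse, length_ascending, ← Finset.card_union_of_disjoint,
    ← Finset.filter_or]
  · congr 1
    exact Finset.filter_congr fun t _ => by rw [le_iff_eq_or_lt]
  · exact Finset.disjoint_filter.2 fun t _ h => by omega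

theorem length_colLabels (L : Finset (Fin n →₀ ℕ)) (δ : ℕ) : (colLabels L δ).length =
    ((frontier L).filter fun t => t.degree = δ).card +
      ((frontier L).filter fun t => t.degree < δ).card + (stdMonomials L).card := by
  rw [colLabels, List.length_append, length_rowLabels, length_ascending]

theorem colLabels_getD_of_lt {i : ℕ} (hi : i < (rowLabels L δ).length) :
    (colLabels L δ).getD i 0 = (rowLabels L δ).getD i 0 :=
  List.getD_append _ _ _ _ hi

theorem colLabels_getD_add (i : ℕ) :
    (colLabels L δ).getD ((rowLabels L δ).length + i) 0 = epsilon L i := by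
  rw [colLabels, List.getD_append_right _ _ _ _ (Nat.le_add_right _ _), add_tsub_cancel_left,
    epsilon]

theorem rowLabels_getD_mem {i : ℕ} (hi : i < (rowLabels L δ).length) :
    (rowLabels L δ).getD i 0 ∈ frontier L ∧ ((rowLabels L δ).getD i 0).degree ≤ δ := by
  rw [List.getD_eq_getElem _ _ hi]
  exact mem_rowLabels.1 (List.getElem_mem hi)

theorem rowLabels_getD_lt {i j : ℕ} (hij : i < j) (hj : j < (rowLabels L δ).length) :
    (drl n).toSyn ((rowLabels L δ).getD j 0) < (drl n).toSyn ((rowLabels L δ).getD i 0) := by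
  rw [List.getD_eq_getElem _ _ hj, List.getD_eq_getElem _ _ (hij.trans hj)]
  exact List.pairwise_iff_getElem.1 (rowLabels_pairwise L δ) i j (hij.trans hj) hj hij

theorem getD_injective {α : Type} {l : List α} (hl : l.Nodup) {N : ℕ} (hN : l.length = N) (d : α) :
    Function.Injective fun i : Fin N => l.getD i d := by
  subst hN
  intro i j h
  simp only [List.getD_eq_getElem _ _ i.2, List.getD_eq_getElem _ _ j.2] at h
  exact Fin.ext (hl.getElem_inj_iff.1 h)

/-- The monomials of degree `δ` come first. -/
theorem degree_rowLabels_getD_lt {i : ℕ}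
    (hs : ((frontier L).filter fun t => t.degree = δ).card ≤ i) (hi : i < (rowLabels L δ).length) :
    ((rowLabels L δ).getD i 0).degree < δ := by
  by_contra hlt
  -- If label `i` had degree `δ`, so would all earlier, larger labels: `i + 1` distinct monomials in
  -- a set of at most `i`.
  have hsub : (Finset.univ : Finset (Fin (i + 1))).image
      (fun j : Fin (i + 1) => (rowLabels L δ).getD j 0) ⊆
      (frontier L).filter fun t => t.degree = δ := by
    intro t ht
    obtain ⟨j, -, rfl⟩ := Finset.mem_image.1 ht
    have hji : (j : ℕ) ≤ i := Nat.lt_succ_iff.1 j.2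
    obtain ⟨h1, h2⟩ := rowLabels_getD_mem (lt_of_le_of_lt hji hi)
    refine Finset.mem_filter.2 ⟨h1, le_antisymm h2 ((not_lt.1 hlt).trans ?_)⟩
    rcases hji.eq_or_lt with h | h
    · rw [h]
    · exact drl_degree_le (rowLabels_getD_lt h hi).le
  have hcard := Finset.card_le_card hsub
  rw [Finset.card_image_of_injective, Finset.card_univ, Fintype.card_fin] at hcard
  · omega
  · intro j k h
    have hj := j.2
    have hk := k.2
    have := getD_injective (rowLabels_nodup L δ) rfl 0 (a₁ := ⟨j, by omega⟩) (a₂ := ⟨k, by omega⟩) h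
    exact Fin.ext (Fin.mk.inj this)

end Labels

/-! ### Correctness of the loop and of the output. -/

section Correctness

open MvPolynomial

variable {n : ℕ} {K : Type u} [Field K] {I : Ideal (MvPolynomial (Fin n) K)}
  {G : Finset (MvPolynomial (Fin n) K)}

/-- The contents of the registers before the reduction in degree `δ`. -/
structure LoopInvariant (I : Ideal (MvPolynomial (Fin n) K)) (G : Finset (MvPolynomial (Fin n) K))
    (δ : ℕ) {ι : Type} (v : ι → K) (zero one : ι) (coef row : (Fin n →₀ ℕ) → (Fin n →₀ ℕ) → ι) :
    Prop where
  zero : v zero = 0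
  one : v one = 1
  coef : ∀ l m, v (coef l m) = inputData G (l, m)
  row : ∀ t ∈ frontier (leadingMonomials G), t.degree < δ → ∀ m,
    v (row t m) = coeff m (relation I (leadingMonomials G) t)

variable {δ : ℕ} {ι : Type} {v : ι → K} {zero one : ι}
  {coef row : (Fin n →₀ ℕ) → (Fin n →₀ ℕ) → ι}

/-- The second clause, that rows of smaller degree are relations, provides the identity block in the
matrix. -/
theorem LoopInvariant.exists_entry (h : LoopInvariant I G δ v zero one coef row)
    (hG : IsReducedGroebnerBasis (drl n) I G)
    (hI : Module.Finite K (MvPolynomial (Fin n) K ⧸ I)) {t : Fin n →₀ ℕ}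
    (ht : t ∈ frontier (leadingMonomials G)) (hδ : t.degree ≤ δ) :
    ∃ q, IsRowPolynomial I (leadingMonomials G) t q ∧
      (t.degree < δ → q = relation I (leadingMonomials G) t) ∧
      ∀ m, v (entry (leadingMonomials G) δ zero coef row t m) = coeff m q := by
  by_cases hlt : t.degree < δ
  · refine ⟨_, hG.isRowPolynomial_relation hI ht, fun _ => rfl, fun m => ?_⟩
    rw [entry, if_pos hlt, h.row t ht hlt]
  by_cases htL : t ∈ leadingMonomials G
  · refine ⟨_, hG.isRowPolynomial_relation hI ht, fun _ => rfl, fun m => ?_⟩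
    rw [entry, if_neg hlt, if_pos htL, h.coef, hG.inputData_eq htL]
  have hex := exists_sub_single_mem_frontier (hG.finite_std hI) ht htL
  refine ⟨_, hG.isRowPolynomial_X_mul hI hex.choose_spec.1 hex.choose_spec.2,
    fun hlt' => absurd hlt' hlt, fun m => ?_⟩
  rw [entry, if_neg hlt, if_neg htL, dif_pos hex, coeff_X_mul']
  by_cases hm : m hex.choose = 0
  · rw [if_pos hm, if_neg fun hk => Finsupp.mem_support_iff.1 hk hm, h.zero]
  · rw [if_neg hm, if_pos (Finsupp.mem_support_iff.2 hm), h.row _ hex.choose_spec.2]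
    have := degree_sub_single hex.choose_spec.1
    omega

/-- One reduction produces all the relations of the frontier monomials of degree `δ`. -/
theorem LoopInvariant.exists_step (h : LoopInvariant I G δ v zero one coef row)
    (hG : IsReducedGroebnerBasis (drl n) I G)
    (hI : Module.Finite K (MvPolynomial (Fin n) K ⧸ I)) (R : RREFRoutine K) {s S : ℕ}
    (hs : s = ((frontier (leadingMonomials G)).filter fun t => t.degree = δ).card)
    (hS : S = ((frontier (leadingMonomials G)).filter fun t => t.degree < δ).card) :
    ∃ w, ((R.prog s S (stdMonomials (leadingMonomials G)).card).rename fun x =>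
        entry (leadingMonomials G) δ zero coef row ((rowLabels (leadingMonomials G) δ).getD x.1 0)
          ((colLabels (leadingMonomials G) δ).getD x.2 0)).eval v = some w ∧
      LoopInvariant I G (δ + 1) (Sum.elim v w) (Sum.inl zero) (Sum.inl one)
        (fun l m => Sum.inl (coef l m)) (readRow (leadingMonomials G) δ zero _ _) := by
  set L := leadingMonomials G with hL
  set D := (stdMonomials L).card with hD
  have hfin := hG.finite_std hI
  have hlen : (rowLabels L δ).length = s + S := by rw [length_rowLabels, hs, hS]
  have hlenc : (colLabels L δ).length = s + S + D := by rw [length_colLabels, hs, hS]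
  have hrl : ∀ i : Fin (s + S), (i : ℕ) < (rowLabels L δ).length := fun i => by rw [hlen]; exact i.2
  have hcast : ∀ i : Fin (s + S), (colLabels L δ).getD (Fin.castAdd D i) 0 =
      (rowLabels L δ).getD i 0 := fun i => colLabels_getD_of_lt (hrl i)
  have hnat : ∀ i : Fin D, (colLabels L δ).getD (Fin.natAdd (s + S) i) 0 = epsilon L i := by
    intro i
    rw [Fin.val_natAdd, ← hlen, colLabels_getD_add]
  have hcl := getD_injective (colLabels_nodup L δ) hlenc 0
  have hex : ∀ m, m ∈ colLabels L δ → ∃ j : Fin (s + S + D), (colLabels L δ).getD j 0 = m := by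
    intro m hm
    obtain ⟨j, hj, rfl⟩ := List.getElem_of_mem hm
    exact ⟨⟨j, hlenc ▸ hj⟩, List.getD_eq_getElem _ _ _⟩
  choose Q hQ hQlt hQc using fun i : Fin (s + S) =>
    h.exists_entry hG hI (rowLabels_getD_mem (hrl i)).1 (rowLabels_getD_mem (hrl i)).2
  set M : Matrix (Fin (s + S)) (Fin (s + S + D)) K := Matrix.of fun i j =>
    v (entry L δ zero coef row ((rowLabels L δ).getD i 0) ((colLabels L δ).getD j 0)) with hM
  have hMQ : ∀ i j, M i j = coeff ((colLabels L δ).getD j 0) (Q i) := fun i j => hQc i _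
  have hsupp : ∀ i m, coeff m (Q i) ≠ 0 → ∃ j : Fin (s + S + D), (colLabels L δ).getD j 0 = m := by
    intro i m hm
    refine hex m (mem_colLabels.2 ?_)
    rcases eq_or_ne m ((rowLabels L δ).getD i 0) with rfl | hne
    · exact Or.inl (rowLabels_getD_mem (hrl i))
    · obtain ⟨h1 | h1, h2⟩ := (hQ i).lt m hm hne
      · exact Or.inr h1
      · exact Or.inl ⟨h1, (drl_degree_le h2.le).trans (rowLabels_getD_mem (hrl i)).2⟩
  have hblock : IsBlockTriangular s S M := by
    intro i j
    refine ⟨fun hij => ?_, fun hij => ?_, fun hsi hij hj => ?_⟩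
    · have hj : j = Fin.castAdd D i := Fin.ext hij
      rw [hMQ, hj, hcast]
      exact (hQ i).coeff_self
    · by_contra hne
      have hj : j = Fin.castAdd D ⟨j, hij.trans i.2⟩ := rfl
      have hlt := rowLabels_getD_lt hij (hrl i)
      rw [hMQ, hj, hcast] at hne
      exact lt_asymm hlt ((hQ i).lt _ hne fun e => by
        simp only at e
        rw [e] at hlt
        exact lt_irrefl _ hlt).2
    -- Apart from its leading monomial, a relation involves only standard monomials, and these are
    -- not in the frontier.
    · by_contra hne
      have hj' : j = Fin.castAdd D ⟨j, hj⟩ := rfl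
      have hlt := rowLabels_getD_lt hij (by rw [hlen]; exact hj)
      rw [hMQ, hj', hcast, hQlt i (degree_rowLabels_getD_lt (hs ▸ hsi) (hrl i))] at hne
      have h1 := hG.mem_and_lt_of_coeff_relation hI hne fun e => by
        simp only at e
        rw [e] at hlt
        exact lt_irrefl _ hlt
      exact (mem_frontier.1 (rowLabels_getD_mem (hrl ⟨j, hj⟩)).1).2 h1.1
  obtain ⟨N, hN, hev⟩ := R.correct s S D M hblock
  have hNrel := hG.rref_eq_coeff_relation hcl
    (fun j => by rw [hnat]; exact (mem_stdMonomials hfin).1 (epsilon_mem j.2))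
    (fun i => (hQ i).mem) hsupp hMQ hblock.isUnit hN
  refine ⟨fun x => N x.1 x.2, ?_, h.zero, h.one, h.coef, fun t ht htδ m => ?_⟩
  · rw [SLP.eval_rename]
    exact hev
  · have htr : t ∈ rowLabels L δ := mem_rowLabels.2 ⟨ht, Nat.lt_succ_iff.1 htδ⟩
    have hti : (rowLabels L δ).idxOf t < s + S := by
      rw [← hlen]
      exact List.idxOf_lt_length_iff.2 htr
    have htt : (rowLabels L δ).getD ((rowLabels L δ).idxOf t) 0 = t := by
      rw [List.getD_eq_getElem _ _ (List.idxOf_lt_length_iff.2 htr), List.getElem_idxOf]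
    rw [readRow]
    by_cases hm : m ∈ colLabels L δ
    · have hmi : (colLabels L δ).idxOf m < s + S + D := by
        rw [← hlenc]
        exact List.idxOf_lt_length_iff.2 hm
      rw [dif_pos ⟨hti, hmi⟩, Sum.elim_inr, hNrel]
      dsimp only
      rw [hcast]
      dsimp only
      rw [htt, List.getD_eq_getElem _ _ (List.idxOf_lt_length_iff.2 hm), List.getElem_idxOf]
    · have hmi : ¬ (colLabels L δ).idxOf m < s + S + D := by
        rw [← hlenc]
        exact fun hlt => hm (List.idxOf_lt_length_iff.1 hlt)
      -- A monomial labelling no column has coefficient `0` in the relation, matching the default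
      -- register of `readRow`.
      rw [dif_neg fun hand => hmi hand.2, Sum.elim_inl, h.zero]
      by_contra hne
      refine hm (mem_colLabels.2 ?_)
      rcases eq_or_ne m t with rfl | hmt
      · exact Or.inl (mem_rowLabels.1 htr)
      · exact Or.inr (hG.mem_and_lt_of_coeff_relation hI (Ne.symm hne) hmt).1

/-- The last stage computes the coefficients of the normal forms. -/
theorem LoopInvariant.eval_finish (h : LoopInvariant I G δ v zero one coef row)
    (hG : IsReducedGroebnerBasis (drl n) I G)
    (hI : Module.Finite K (MvPolynomial (Fin n) K ⧸ I))
    (hδ : ∀ t ∈ frontier (leadingMonomials G), t.degree < δ) :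
    (finish K (leadingMonomials G) zero one row).eval v = some fun x =>
      coeff (epsilon (leadingMonomials G) x.2.1) (normalForm I (leadingMonomials G)
        (epsilon (leadingMonomials G) x.2.2 + Finsupp.single x.1 1)) := by
  have hfin := hG.finite_std hI
  rw [finish, SLP.eval_andThen, SLP.eval_negate _ _ _ _ (Finset.nodup_toList _) h.zero,
    Option.bind_some, SLP.eval]
  congr 1
  funext ⟨k, i, j⟩
  dsimp only
  by_cases hB : epsilon (leadingMonomials G) j + Finsupp.single k 1 ∈
      stdMonomials (leadingMonomials G)
  · rw [if_pos hB, hG.normalForm_of_std ((mem_stdMonomials hfin).1 hB), coeff_monomial]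
    by_cases he : epsilon (leadingMonomials G) i = epsilon (leadingMonomials G) j +
        Finsupp.single k 1
    · rw [if_pos he, if_pos he.symm, Sum.elim_inl, h.one]
    · rw [if_neg he, if_neg fun e => he e.symm, Sum.elim_inl, h.zero]
  · have hF : epsilon (leadingMonomials G) j + Finsupp.single k 1 ∈
        frontier (leadingMonomials G) :=
      mem_frontier.2 ⟨⟨_, epsilon_mem j.2, k, rfl⟩, hB⟩
    have hi := epsilon_mem i.2
    have hmem : (epsilon (leadingMonomials G) j + Finsupp.single k 1,
        epsilon (leadingMonomials G) i) ∈
        (frontier (leadingMonomials G) ×ˢ stdMonomials (leadingMonomials G)).toList :=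
      Finset.mem_toList.2 (Finset.mem_product.2 ⟨hF, hi⟩)
    rw [if_neg hB, Sum.elim_inr, if_pos hmem, h.row _ hF (hδ _ hF), relation, coeff_sub,
      coeff_monomial, if_neg, zero_sub, neg_neg]
    intro e
    rw [e] at hB
    exact hB hi

theorem eval_loop (hG : IsReducedGroebnerBasis (drl n) I G)
    (hI : Module.Finite K (MvPolynomial (Fin n) K ⧸ I)) (R : RREFRoutine K) :
    ∀ (N δ : ℕ) {ι : Type} {v : ι → K} {zero one : ι}
      {coef row : (Fin n →₀ ℕ) → (Fin n →₀ ℕ) → ι}, LoopInvariant I G δ v zero one coef row →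
      (∀ t ∈ frontier (leadingMonomials G), t.degree < δ + N) →
      (loop R (leadingMonomials G) (List.range' δ N) zero one coef row).eval v = some fun x =>
        coeff (epsilon (leadingMonomials G) x.2.1) (normalForm I (leadingMonomials G)
          (epsilon (leadingMonomials G) x.2.2 + Finsupp.single x.1 1))
  | 0, _, _, _, _, _, _, _, h, hδ => h.eval_finish hG hI hδ
  | N + 1, δ, _, _, _, _, _, _, h, hδ => by
    obtain ⟨w, hw, hinv⟩ := h.exists_step hG hI R rfl rfl
    rw [List.range'_succ, loop, SLP.eval_andThen, hw]
    exact eval_loop hG hI R N (δ + 1) hinv fun t ht => by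
      have := hδ t ht
      omega

theorem dMin_le {L : Finset (Fin n →₀ ℕ)} {t : Fin n →₀ ℕ} (ht : t ∈ frontier L) :
    dMin L ≤ t.degree :=
  Nat.sInf_le ⟨t, ht, rfl⟩

theorem le_dMax {L : Finset (Fin n →₀ ℕ)} {t : Fin n →₀ ℕ} (ht : t ∈ frontier L) :
    t.degree ≤ dMax L :=
  Finset.le_sup (f := fun t : Fin n →₀ ℕ => t.degree) ht

/-- Makes the natural subtraction in the number of steps exact. For an empty frontier both sides are
`0`. -/
theorem dMin_le_dMax (L : Finset (Fin n →₀ ℕ)) : dMin L ≤ dMax L := by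
  rcases (frontier L).eq_empty_or_nonempty with h | ⟨t, ht⟩
  · simp [dMin, h]
  · exact (dMin_le ht).trans (le_dMax ht)

/-- The output of the algorithm, for every correct subroutine. -/
theorem eval_algorithm (hG : IsReducedGroebnerBasis (drl n) I G)
    (hI : Module.Finite K (MvPolynomial (Fin n) K ⧸ I)) (R : RREFRoutine K) :
    (algorithm R (leadingMonomials G)).eval (inputData G) = some fun x =>
      coeff (epsilon (leadingMonomials G) x.2.1) (normalForm I (leadingMonomials G)
        (epsilon (leadingMonomials G) x.2.2 + Finsupp.single x.1 1)) := by
  rw [algorithm, SLP.eval, SLP.eval]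
  refine eval_loop hG hI R _ _ ⟨rfl, rfl, fun _ _ => rfl, fun t ht hlt => ?_⟩ fun t ht => ?_
  -- Initially no relation need be known, as no frontier monomial has degree below `dMin`.
  · exact absurd (dMin_le ht) (not_le.2 hlt)
  · have := le_dMax ht
    have := dMin_le_dMax (leadingMonomials G)
    omega

end Correctness

/-! ### Operation count. -/

section Cost

variable {n : ℕ} {K : Type u}

theorem cost_finish (L : Finset (Fin n →₀ ℕ)) {ι : Type} (zero one : ι)
    (row : (Fin n →₀ ℕ) → (Fin n →₀ ℕ) → ι) :
    (finish K L zero one row).cost = (frontier L).card * (stdMonomials L).card := by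
  rw [finish, SLP.cost_andThen, SLP.cost_negate, Finset.length_toList, Finset.card_product]
  rfl

variable [Field K]

theorem cost_loop_le (R : RREFRoutine K) (L : Finset (Fin n →₀ ℕ)) {A : ℝ}
    (hA : ∀ δ, ((R.prog ((frontier L).filter fun t => t.degree = δ).card
      ((frontier L).filter fun t => t.degree < δ).card (stdMonomials L).card).cost : ℝ) ≤ A) :
    ∀ (ds : List ℕ) {ι : Type} (zero one : ι) (coef row : (Fin n →₀ ℕ) → (Fin n →₀ ℕ) → ι),
      ((loop R L ds zero one coef row).cost : ℝ) ≤
        ds.length * A + (frontier L).card * (stdMonomials L).card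
  | [], _, _, _, _, _ => by
    rw [loop, cost_finish]
    simp
  | δ :: ds, _, _, _, _, _ => by
    rw [loop, SLP.cost_andThen, SLP.cost_rename]
    rw [Nat.cast_add]
    refine (add_le_add (hA δ) (cost_loop_le R L hA ds _ _ _ _)).trans (le_of_eq ?_)
    rw [List.length_cons]
    push_cast
    ring

theorem natCast_sq_le_rpow {ω : ℝ} (hω : 2 ≤ ω) (m : ℕ) : (m : ℝ) ^ 2 ≤ (m : ℝ) ^ ω := by
  rcases Nat.eq_zero_or_pos m with rfl | hm
  · rw [Nat.cast_zero, Real.zero_rpow (by linarith)]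
    norm_num
  · rw [← Real.rpow_two]
    exact Real.rpow_le_rpow_of_exponent_le (by exact_mod_cast hm) hω

/-- The cost of the algorithm with a subroutine as fast as a matrix product. -/
theorem cost_algorithm_le {ω B : ℝ} (hω : 2 ≤ ω) (hB : 0 ≤ B) {R : RREFRoutine K}
    (hR : ∀ s S D : ℕ, (s = 0 → (R.prog s S D).cost = 0) ∧
      ((R.prog s S D).cost : ℝ) ≤ B * ((max (s + S) D : ℕ) : ℝ) ^ ω) (L : Finset (Fin n →₀ ℕ)) :
    ((algorithm R L).cost : ℝ) ≤ (B + 1) * ((dMax L : ℝ) - dMin L + 1) * (n : ℝ) ^ ω *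
      ((stdMonomials L).card : ℝ) ^ ω := by
  set D := (stdMonomials L).card with hD
  have hA : ∀ δ, ((R.prog ((frontier L).filter fun t => t.degree = δ).card
      ((frontier L).filter fun t => t.degree < δ).card D).cost : ℝ) ≤
        B * ((n : ℝ) ^ ω * (D : ℝ) ^ ω) := by
    intro δ
    obtain ⟨h0, h1⟩ := hR ((frontier L).filter fun t => t.degree = δ).card
      ((frontier L).filter fun t => t.degree < δ).card D
    rcases Nat.eq_zero_or_pos ((frontier L).filter fun t => t.degree = δ).card with hs | hs
    · rw [h0 hs, Nat.cast_zero]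
      positivity
    · refine h1.trans (mul_le_mul_of_nonneg_left ?_ hB)
      rw [← Real.mul_rpow (Nat.cast_nonneg _) (Nat.cast_nonneg _), ← Nat.cast_mul]
      refine Real.rpow_le_rpow (Nat.cast_nonneg _) (Nat.cast_le.2 ?_) (by linarith)
      have hF : ((frontier L).filter fun t => t.degree = δ).card +
          ((frontier L).filter fun t => t.degree < δ).card ≤ (frontier L).card := by
        rw [← Finset.card_union_of_disjoint]
        · exact Finset.card_le_card
            (Finset.union_subset (Finset.filter_subset _ _) (Finset.filter_subset _ _))
        · exact Finset.disjoint_filter.2 fun t _ h => by omega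
      have hF' := hF.trans card_frontier_le
      -- `D ≤ n D` requires `n ≠ 0`, which holds because some frontier monomial has degree `δ`.
      refine max_le hF' (Nat.le_mul_of_pos_left D (Nat.pos_of_ne_zero ?_))
      rintro rfl
      rw [zero_mul] at hF'
      omega
  have h := cost_loop_le R L hA (List.range' (dMin L) (dMax L - dMin L + 1)) (some none) none
    (fun l m => some (some (l, m))) (fun _ _ => some none)
  rw [List.length_range'] at h
  have hFD : ((frontier L).card : ℝ) * D ≤ (n : ℝ) ^ ω * (D : ℝ) ^ ω := by
    have h1 : (frontier L).card * D ≤ n ^ 2 * D ^ 2 := by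
      calc (frontier L).card * D ≤ n * D * D := Nat.mul_le_mul_right _ card_frontier_le
        _ = n * D ^ 2 := by ring
        _ ≤ n ^ 2 * D ^ 2 := Nat.mul_le_mul_right _ (Nat.le_self_pow two_ne_zero n)
    calc ((frontier L).card : ℝ) * D ≤ (n : ℝ) ^ 2 * (D : ℝ) ^ 2 := by exact_mod_cast h1
      _ ≤ _ := mul_le_mul (natCast_sq_le_rpow hω n) (natCast_sq_le_rpow hω D) (by positivity)
        (by positivity)
  have hlen : ((dMax L - dMin L + 1 : ℕ) : ℝ) = (dMax L : ℝ) - dMin L + 1 := by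
    rw [Nat.cast_add, Nat.cast_sub (dMin_le_dMax L), Nat.cast_one]
  have h1 : (1 : ℝ) ≤ (dMax L : ℝ) - dMin L + 1 := by
    have : (dMin L : ℝ) ≤ dMax L := Nat.cast_le.2 (dMin_le_dMax L)
    linarith
  rw [hlen] at h
  have hpos : (0 : ℝ) ≤ (n : ℝ) ^ ω * (D : ℝ) ^ ω := by positivity
  calc ((algorithm R L).cost : ℝ) ≤ _ := h
    -- The sign changes occur only once, but the number of degrees is at least `1`; they account for
    -- the `+ 1` in `B + 1`.
    _ ≤ ((dMax L : ℝ) - dMin L + 1) * (B * ((n : ℝ) ^ ω * (D : ℝ) ^ ω)) +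
        ((dMax L : ℝ) - dMin L + 1) * ((n : ℝ) ^ ω * (D : ℝ) ^ ω) :=
      add_le_add le_rfl (hFD.trans (le_mul_of_one_le_left hpos h1))
    _ = _ := by ring

end Cost

end MultMat

/-! ### The main theorem. -/

theorem mainTheorem6 (ω c : ℝ) (hω : 2 ≤ ω) :
    ∃ C : ℝ, ∀ (K : Type u) [Field K], MultMat.MatMulCost K ω c →
      ∃ R : MultMat.RREFRoutine K,
        ∀ (n : ℕ) (I : Ideal (MvPolynomial (Fin n) K)) (G : Finset (MvPolynomial (Fin n) K)),
          Module.Finite K (MvPolynomial (Fin n) K ⧸ I) →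
          MultMat.IsReducedGroebnerBasis (MultMat.drl n) I G →
          (∃ b : Module.Basis (Fin (MultMat.stdMonomials (MultMat.leadingMonomials G)).card) K
                (MvPolynomial (Fin n) K ⧸ I),
            (∀ i, b i = Ideal.Quotient.mk I
              (MvPolynomial.monomial (MultMat.epsilon (MultMat.leadingMonomials G) i) 1)) ∧
            ∀ R' : MultMat.RREFRoutine K,
              (MultMat.algorithm R' (MultMat.leadingMonomials G)).eval (MultMat.inputData G) =
                some fun x => LinearMap.toMatrix b b
                  (LinearMap.mulLeft K (Ideal.Quotient.mk I (MvPolynomial.X x.1))) x.2.1 x.2.2) ∧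
          ((MultMat.algorithm R (MultMat.leadingMonomials G)).cost : ℝ) ≤
            C * ((MultMat.dMax (MultMat.leadingMonomials G) : ℝ) -
                  MultMat.dMin (MultMat.leadingMonomials G) + 1) *
              (n : ℝ) ^ ω * (Module.finrank K (MvPolynomial (Fin n) K ⧸ I) : ℝ) ^ ω ∧
          ∀ d : ℕ, Module.finrank K (MvPolynomial (Fin n) K ⧸ I) ≤ d ^ n →
            ((MultMat.algorithm R (MultMat.leadingMonomials G)).cost : ℝ) ≤
              C * ((MultMat.dMax (MultMat.leadingMonomials G) : ℝ) -
                    MultMat.dMin (MultMat.leadingMonomials G) + 1) *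
                (n : ℝ) ^ ω * (d : ℝ) ^ (ω * n) := by
  refine ⟨(2 * c + 1) * 2 ^ ω + 1, fun K _ hc => ?_⟩
  have hc0 := hc.nonneg
  obtain ⟨R, hR⟩ := MultMat.exists_rrefRoutine hω hc
  refine ⟨R, fun n I G hI hG => ?_⟩
  obtain ⟨b, hb, hrepr⟩ := hG.exists_basis hI
  have hcard : Module.finrank K (MvPolynomial (Fin n) K ⧸ I) =
      (MultMat.stdMonomials (MultMat.leadingMonomials G)).card := by
    rw [Module.finrank_eq_card_basis b, Fintype.card_fin]
  have hcost := MultMat.cost_algorithm_le hω (by positivity) hR (MultMat.leadingMonomials G)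
  rw [hcard]
  refine ⟨⟨b, hb, fun R' => ?_⟩, hcost, fun d hd => hcost.trans ?_⟩
  · rw [MultMat.eval_algorithm hG hI R']
    congr 1
    funext x
    -- Column `j` of `T_k` is the class of the monomial `x_k ε_j`, whose coordinates are the
    -- coefficients of its normal form.
    rw [LinearMap.toMatrix_apply, LinearMap.mulLeft_apply, hb, ← map_mul, MvPolynomial.X,
      MvPolynomial.monomial_mul, one_mul, add_comm, hrepr]
  · have hle : (MultMat.dMin (MultMat.leadingMonomials G) : ℝ) ≤
        MultMat.dMax (MultMat.leadingMonomials G) :=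
      Nat.cast_le.2 (MultMat.dMin_le_dMax _)
    have hpow : (d : ℝ) ^ (ω * n) = ((d ^ n : ℕ) : ℝ) ^ ω := by
      rw [mul_comm, Real.rpow_mul (Nat.cast_nonneg _), Real.rpow_natCast, Nat.cast_pow]
    rw [hpow]
    refine mul_le_mul_of_nonneg_left
      (Real.rpow_le_rpow (Nat.cast_nonneg _) (Nat.cast_le.2 hd) (by linarith)) ?_
    have h1 : 0 ≤ (MultMat.dMax (MultMat.leadingMonomials G) : ℝ) -
        MultMat.dMin (MultMat.leadingMonomials G) + 1 := by linarith
    positivity
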